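/- Throughout, $\log$ is the logarithm to base $2$ (with $\log 0:=0$ in functions of operators, i.e. logarithms of positive semidefinite operators are taken on their supports), and $\mathcal{H}_B$ is a finite-dimensional Hilbert space. Let $$\rho_{XB}=\sum_{x\in\mathcal{X}}p(x)\,|x\rangle\langle x|\otimes\rho_B^x$$ be a classical-quantum state, where $p$ is a probability mass function on the finite alphabet $\mathcal{X}$ and each $\rho_B^x$ is a density operator on $\mathcal{H}_B$; put $\rho_B:=\operatorname{Tr}_X\rho_{XB}$. Let $H(\omega):=-\operatorname{Tr}[\omega\log\omega]$, $H(X|B)_\rho:=H(\rho_{XB})-H(\rho_B)$, and $$V(X|B)_\rho:=V(\rho_{XB}\|\mathbb{1}_X\otimes\rho_B),$$ $$V(\rho\|\sigma):=\operatorname{Tr}[\rho(\log\rho-\log\sigma)^2]-D(\rho\|\sigma)^2,\qquad D(\rho\|\sigma):=\operatorname{Tr}[\rho(\log\rho-\log\sigma)].$$ For $n\in\mathbb{N}$ and $R>0$, an $(n,R)$-code $\mathcal{C}$ consists of an encoding map $\mathcal{E}:\mathcal{X}^n\to\mathcal{W}$, where $|\mathcal{W}|=\lceil 2^{nR}\rceil<|\mathcal{X}|^n$,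 and, for each $w\in\mathcal{W}$, a POVM $\{\Pi^{(w)}_{\mathbf{x}}\}_{\mathbf{x}\in\mathcal{X}^n}$ on $\mathcal{H}_B^{\otimes n}$. Its error probability is $$P_{\mathrm{e}}(\mathcal{C}):=1-\sum_{\mathbf{x}\in\mathcal{X}^n}p(x_1)\cdots p(x_n)\operatorname{Tr}\!\left[\Pi^{(\mathcal{E}(\mathbf{x}))}_{\mathbf{x}}\,\rho_B^{x_1}\otimes\cdots\otimes\rho_B^{x_n}\right],$$ and the optimal rate at error threshold $\varepsilon$ is $$R^*(n,\varepsilon):=\inf\{R>0:\ \text{there is an }(n,R)\text{-code }\mathcal{C}\text{ with }P_{\mathrm{e}}(\mathcal{C})\le\varepsilon\}.$$ **Theorem.** Assume that $V(X|B)_\rho>0$. Then for every sequence $(a_n)_{n\in\mathbb{N}}$ of real numbers with $a_n\to0$ and $a_n\sqrt{n}\to+\infty$ as $n\to\infty$, and $\varepsilon_n:=e^{-na_n^2}$ (with $e$ the base of the natural logarithm), one has, as $n\to\infty$, $$R^*(n,\varepsilon_n)=H(X|B)_\rho+\sqrt{2V(X|B)_\rho}\;a_n+o(a_n).$$ -/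

import Mathlib

open scoped Kronecker ComplexOrder

noncomputable section

/-- A classical-quantum state `∑ x, p x |x⟩⟨x| ⊗ ρ x`: a probability mass function `p` on the
finite alphabet `X` and, for each letter `x`, a density matrix `ρ x` on the Hilbert space `ℂ^d`. -/
structure CQState (X d : Type*) [Fintype X] [Fintype d] where
  /-- The probability mass function of the letters. -/
  p : X → ℝ
  /-- The conditional states of the quantum side information. -/
  state : X → Matrix d d ℂ
  p_nonneg : ∀ x, 0 ≤ p x
  p_sum : ∑ x, p x = 1
  state_posSemidef : ∀ x, (state x).PosSemidef
  state_trace : ∀ x, (state x).trace = 1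

/-- The bipartite density matrix `ρ_XB = ∑ x, p x |x⟩⟨x| ⊗ ρ x`. -/
def CQState.toMatrix {X d : Type*} [Fintype X] [DecidableEq X] [Fintype d]
    (S : CQState X d) : Matrix (X × d) (X × d) ℂ :=
  ∑ x, (S.p x : ℂ) • (Matrix.single x x (1 : ℂ) ⊗ₖ S.state x)

/-- The partial trace over the first tensor factor. -/
def ptraceFst {ι d : Type*} [Fintype ι] (M : Matrix (ι × d) (ι × d) ℂ) : Matrix d d ℂ :=
  Matrix.of fun i j => ∑ x, M (x, i) (x, j)

/-- The base-2 logarithm of a Hermitian matrix, by functional calculus. Zero eigenvalues are sent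
to `0`, i.e. the logarithm is taken on the support. -/
def matLog {ι : Type*} [Fintype ι] [DecidableEq ι] (A : Matrix ι ι ℂ) : Matrix ι ι ℂ :=
  cfc (Real.logb 2) A

/-- The von Neumann entropy `H(ω) = - tr (ω log ω)`, in bits. -/
def vonNeumannEntropy {ι : Type*} [Fintype ι] [DecidableEq ι] (ω : Matrix ι ι ℂ) : ℝ :=
  -(ω * matLog ω).trace.re

/-- The conditional entropy `H(A|B)_ρ = H(ρ_AB) - H(ρ_B)`. -/
def condEntropy {ι d : Type*} [Fintype ι] [DecidableEq ι] [Fintype d] [DecidableEq d]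
    (ρ : Matrix (ι × d) (ι × d) ℂ) : ℝ :=
  vonNeumannEntropy ρ - vonNeumannEntropy (ptraceFst ρ)

/-- The relative entropy `D(ρ‖σ) = tr (ρ (log ρ - log σ))`, for `supp ρ ⊆ supp σ`. -/
def relEntropy {ι : Type*} [Fintype ι] [DecidableEq ι] (ρ σ : Matrix ι ι ℂ) : ℝ :=
  (ρ * (matLog ρ - matLog σ)).trace.re

/-- The relative entropy variance `V(ρ‖σ) = tr (ρ (log ρ - log σ)²) - D(ρ‖σ)²`,
for `supp ρ ⊆ supp σ`. -/
def relEntropyVariance {ι : Type*} [Fintype ι] [DecidableEq ι] (ρ σ : Matrix ι ι ℂ) : ℝ :=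
  (ρ * (matLog ρ - matLog σ) ^ 2).trace.re - relEntropy ρ σ ^ 2

/-- The conditional information variance `V(A|B)_ρ = V(ρ_AB ‖ 𝟙_A ⊗ ρ_B)`. The support of `ρ_AB`
is always contained in that of `𝟙_A ⊗ ρ_B`. -/
def condInfoVariance {ι d : Type*} [Fintype ι] [DecidableEq ι] [Fintype d] [DecidableEq d]
    (ρ : Matrix (ι × d) (ι × d) ℂ) : ℝ :=
  relEntropyVariance ρ ((1 : Matrix ι ι ℂ) ⊗ₖ ptraceFst ρ)

/-- The tensor product `A 0 ⊗ ⋯ ⊗ A (n-1)` of `n` matrices on `ℂ^d`, as a matrix on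
`(ℂ^d)^⊗n`, whose standard basis is indexed by `Fin n → d`. -/
def tensorFamily {d : Type*} {n : ℕ} (A : Fin n → Matrix d d ℂ) :
    Matrix (Fin n → d) (Fin n → d) ℂ :=
  Matrix.of fun i j => ∏ k, A k (i k) (j k)

/-- An `(n, R)`-code: an encoding map into an alphabet of size `⌈2^(nR)⌉ < |X|^n` and, for each
compressed message, a measurement (POVM) on the side information `(ℂ^d)^⊗n` with outcomes
in `X^n`. -/
structure SWCode (X d : Type*) [Fintype X] [DecidableEq X] [Fintype d] [DecidableEq d]
    (n : ℕ) (R : ℝ) where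
  /-- The encoding map. -/
  enc : (Fin n → X) → Fin ⌈(2 : ℝ) ^ ((n : ℝ) * R)⌉₊
  /-- The decoding measurements: `dec w x` is the POVM element of outcome `x` given `w`. -/
  dec : Fin ⌈(2 : ℝ) ^ ((n : ℝ) * R)⌉₊ → (Fin n → X) → Matrix (Fin n → d) (Fin n → d) ℂ
  size_lt : ⌈(2 : ℝ) ^ ((n : ℝ) * R)⌉₊ < Fintype.card X ^ n
  dec_posSemidef : ∀ w x, (dec w x).PosSemidef
  dec_sum : ∀ w, ∑ x, dec w x = 1

/-- The error probability
`P_e = 1 - ∑ x, p(x₁)⋯p(xₙ) tr [Π_x^(E(x)) (ρ^x₁ ⊗ ⋯ ⊗ ρ^xₙ)]` of a code. -/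
def SWCode.errorProb {X d : Type*} [Fintype X] [DecidableEq X] [Fintype d] [DecidableEq d]
    {n : ℕ} {R : ℝ} (C : SWCode X d n R) (S : CQState X d) : ℝ :=
  1 - ∑ x : Fin n → X, (∏ k, S.p (x k)) *
    (C.dec (C.enc x) x * tensorFamily fun k => S.state (x k)).trace.re

/-- The optimal rate `R*(n, ε)`: the infimum of the rates `R > 0` for which there is an
`(n, R)`-code with error probability at most `ε`. -/
def optimalRate {X d : Type*} [Fintype X] [DecidableEq X] [Fintype d] [DecidableEq d]
    (S : CQState X d) (n : ℕ) (ε : ℝ) : ℝ :=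
  sInf {R : ℝ | 0 < R ∧ ∃ C : SWCode X d n R, C.errorProb S ≤ ε}

end

set_option linter.unusedSectionVars false

/-! The problem reduces to a sum of independent real random variables. Let `A x = p x • ρ x` have
eigenvalues `λ` and eigenvectors `u`, and let `B = ρ_B` have eigenvalues `m` and eigenvectors `w`.
The Nussbaum–Szkoła weights `λ_{x,i} |⟨u_{x,i}, w_j⟩|²` form a probability distribution on `X × d ×
d`. Under it the log-ratio `Z = log m_j - log λ_{x,i}` has mean `H(X|B)` and variance `V(X|B)`.
Tensor powers turn this distribution into a product measure and `Z` into a sum of `n` independent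
copies.

Achievability: encode by random binning into `M` bins. For each letter take a test of `A x` against
`B / M`, bounded by Audenaert's inequality (`exists_test_le_petz`), and decode with the square-root
measurement (`exists_hayashiNagaoka`). Up to the regularization term the error is at most `4 M^{-s}
(E 2^{sZ})^n` (`SpectralFamily.exists_code`). This is a Chernoff bound, and choosing `s`
proportional to `a n` makes only the quadratic Taylor term of the cumulant matter.

Converse: every decoder is a family of tests, so the Nussbaum–Szkoła inequality (`min_sum_le_test`)
bounds `∑ min(λ, c m)` by twice `P_e + c M` (`SpectralFamily.minSum_le`). The left side dominates a
tail probability of the sum of the `Z`'s (`tail_le_minSum_tensorPower`), and exponential tilting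
bounds that tail below by the Gaussian exponent (`exists_tail_lower_bound`).

For every small `δ > 0` the optimal rate is thus eventually between `H + √(2V) (1 ± δ) a n`, which
is the claim. The constraints `R > 0` and `⌈2^(nR)⌉ < |X|^n` must also hold near `H`. They follow
from `0 ≤ H` and the strict bound `H < log |X|`; strictness comes from `V > 0`. -/

section Preliminaries

open Matrix Filter Topology

/-! ### Explicitly diagonalized matrices and overlaps of eigenbases. -/

section DiagConj

variable {D : Type*} [Fintype D] [DecidableEq D]

/-- The matrix with eigenvalues `l` in the basis given by the columns of `U`. -/
def diagConj (U : Matrix D D ℂ) (l : D → ℝ) : Matrix D D ℂ :=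
  U * diagonal (fun i => (l i : ℂ)) * Uᴴ

/-- The transition probabilities between the bases given by the columns of `U` and `W`. -/
def overlap (U W : Matrix D D ℂ) (i j : D) : ℝ := Complex.normSq ((Uᴴ * W) i j)

theorem overlap_nonneg (U W : Matrix D D ℂ) (i j : D) : 0 ≤ overlap U W i j :=
  Complex.normSq_nonneg _

theorem diagConj_mul {U : Matrix D D ℂ} (hU : U ∈ unitaryGroup D ℂ) (f g : D → ℝ) :
    diagConj U f * diagConj U g = diagConj U (fun i => f i * g i) := by
  have h : Uᴴ * U = 1 := mem_unitaryGroup_iff'.mp hU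
  unfold diagConj
  calc _ = U * diagonal (fun i => (f i : ℂ)) * (Uᴴ * U) * diagonal (fun i => (g i : ℂ)) * Uᴴ := by
        simp only [Matrix.mul_assoc]
    _ = _ := by
        rw [h, Matrix.mul_one, Matrix.mul_assoc U, diagonal_mul_diagonal]
        simp

theorem diagConj_add (U : Matrix D D ℂ) (f g : D → ℝ) :
    diagConj U (fun i => f i + g i) = diagConj U f + diagConj U g := by
  unfold diagConj
  rw [← Matrix.add_mul, ← Matrix.mul_add, diagonal_add]
  simp

theorem diagConj_smul (U : Matrix D D ℂ) (c : ℝ) (f : D → ℝ) :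
    diagConj U (fun i => c * f i) = (c : ℂ) • diagConj U f := by
  unfold diagConj
  rw [← Matrix.smul_mul, ← Matrix.mul_smul, ← diagonal_smul]
  congr 3
  ext i
  simp

theorem diagConj_const {U : Matrix D D ℂ} (hU : U ∈ unitaryGroup D ℂ) (c : ℝ) :
    diagConj U (fun _ => c) = (c : ℂ) • (1 : Matrix D D ℂ) := by
  have h : U * Uᴴ = 1 := mem_unitaryGroup_iff.mp hU
  unfold diagConj
  rw [← smul_one_eq_diagonal]
  simp [h]

theorem diagConj_isHermitian (U : Matrix D D ℂ) (l : D → ℝ) : (diagConj U l).IsHermitian := by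
  unfold diagConj
  apply isHermitian_mul_mul_conjTranspose
  rw [isHermitian_diagonal_iff]
  intro i
  simp [IsSelfAdjoint]

theorem diagConj_posSemidef (U : Matrix D D ℂ) {l : D → ℝ} (hl : ∀ i, 0 ≤ l i) :
    (diagConj U l).PosSemidef := by
  unfold diagConj
  refine PosSemidef.mul_mul_conjTranspose_same (PosSemidef.diagonal ?_) U
  intro i
  simpa using hl i

theorem exists_eq_diagConj {A : Matrix D D ℂ} (hA : A.IsHermitian) :
    ∃ U ∈ unitaryGroup D ℂ, ∃ l : D → ℝ, A = diagConj U l :=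
  ⟨hA.eigenvectorUnitary, hA.eigenvectorUnitary.2, hA.eigenvalues, by
    conv_lhs => rw [hA.spectral_theorem]
    rfl⟩

theorem exists_eq_diagConj_of_posSemidef {A : Matrix D D ℂ} (hA : A.PosSemidef) :
    ∃ U ∈ unitaryGroup D ℂ, ∃ l : D → ℝ, (∀ i, 0 ≤ l i) ∧ A = diagConj U l :=
  ⟨hA.1.eigenvectorUnitary, hA.1.eigenvectorUnitary.2, hA.1.eigenvalues, hA.eigenvalues_nonneg, by
    conv_lhs => rw [hA.1.spectral_theorem]
    rfl⟩

theorem conjTranspose_mul_diagConj_mul {U : Matrix D D ℂ} (hU : U ∈ unitaryGroup D ℂ)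
    (l : D → ℝ) : Uᴴ * diagConj U l * U = diagonal (fun i => (l i : ℂ)) := by
  have h : Uᴴ * U = 1 := mem_unitaryGroup_iff'.mp hU
  unfold diagConj
  calc _ = (Uᴴ * U) * diagonal (fun i => (l i : ℂ)) * (Uᴴ * U) := by
        simp only [Matrix.mul_assoc]
    _ = _ := by simp [h]

open Polynomial in
theorem aeval_diagConj {U : Matrix D D ℂ} (hU : U ∈ unitaryGroup D ℂ) (l : D → ℝ) (q : ℝ[X]) :
    aeval (diagConj U l) q = diagConj U (fun i => q.eval (l i)) := by
  induction q using Polynomial.induction_on' with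
  | add p q hp hq => simp only [map_add, hp, hq, eval_add, diagConj_add]
  | monomial n c =>
    have hpow : ∀ n : ℕ, diagConj U l ^ n = diagConj U (fun i => l i ^ n) := by
      intro n
      induction n with
      | zero => simpa using (diagConj_const hU 1).symm
      | succ k ih => rw [pow_succ, ih, diagConj_mul hU]; rfl
    simp only [aeval_monomial, hpow, eval_monomial, diagConj_smul]
    rw [Algebra.algebraMap_eq_smul_one, smul_mul_assoc, one_mul]
    ext i j
    simp

theorem spectrum_diagConj_subset {U : Matrix D D ℂ} (hU : U ∈ unitaryGroup D ℂ) (l : D → ℝ) :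
    spectrum ℝ (diagConj U l) ⊆ Set.range l := by
  intro t ht
  by_contra hn
  apply ht
  have hne : ∀ i, t - l i ≠ 0 := fun i h => hn ⟨i, by linarith⟩
  have e : algebraMap ℝ (Matrix D D ℂ) t - diagConj U l = diagConj U (fun i => t - l i) := by
    have h1 : algebraMap ℝ (Matrix D D ℂ) t = diagConj U (fun _ => t) := by
      rw [diagConj_const hU, Algebra.algebraMap_eq_smul_one]
      ext i j
      simp
    rw [h1, sub_eq_iff_eq_add, ← diagConj_add]
    simp
  rw [spectrum.mem_resolventSet_iff, e]
  refine ⟨⟨diagConj U (fun i => t - l i), diagConj U (fun i => (t - l i)⁻¹), ?_, ?_⟩, rfl⟩ <;>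
  · rw [diagConj_mul hU]
    simp [hne, diagConj_const hU]

/-- The functional calculus of a diagonalized matrix acts on its eigenvalues. -/
theorem cfc_diagConj {U : Matrix D D ℂ} (hU : U ∈ unitaryGroup D ℂ) (l : D → ℝ) (f : ℝ → ℝ) :
    cfc f (diagConj U l) = diagConj U (fun i => f (l i)) := by
  classical
  have hsa : IsSelfAdjoint (diagConj U l) := diagConj_isHermitian U l
  -- The spectrum lies in the finite set of values of `l`, so `f` may be replaced by an
  -- interpolating polynomial.
  set q := Lagrange.interpolate (Finset.univ.image l) id f with hq
  have hev : ∀ i, q.eval (l i) = f (l i) := fun i =>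
    Lagrange.eval_interpolate_at_node (v := id) f (Set.injOn_id _)
      (Finset.mem_image_of_mem l (Finset.mem_univ i))
  have h1 : cfc f (diagConj U l) = cfc q.eval (diagConj U l) := by
    apply cfc_congr
    intro t ht
    obtain ⟨i, rfl⟩ := spectrum_diagConj_subset hU l ht
    exact (hev i).symm
  rw [h1, cfc_polynomial q _ hsa, aeval_diagConj hU]
  simp [hev]

/-- Turns traces of products of non-commuting matrices into classical double sums. Unitarity is not
assumed: the converse applies it to matrices such as `(1 - T) * W`. -/
theorem trace_diagConj_mul_diagConj (U W : Matrix D D ℂ) (f g : D → ℝ) :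
    (diagConj U f * diagConj W g).trace
      = ((∑ i, ∑ j, f i * g j * overlap U W i j : ℝ) : ℂ) := by
  have h : (diagConj U f * diagConj W g).trace
      = (diagonal (fun i => (f i : ℂ)) * (Uᴴ * W) * diagonal (fun i => (g i : ℂ))
          * (Uᴴ * W)ᴴ).trace := by
    unfold diagConj
    rw [conjTranspose_mul, conjTranspose_conjTranspose]
    calc _ = (U * (diagonal (fun i => (f i : ℂ)) * Uᴴ * (W * diagonal (fun i => (g i : ℂ))
                * Wᴴ))).trace := by simp only [Matrix.mul_assoc]
      _ = _ := by rw [trace_mul_comm]; simp only [Matrix.mul_assoc]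
  rw [h]
  set K := Uᴴ * W with hK
  push_cast
  refine Finset.sum_congr rfl fun i _ => ?_
  rw [diag_apply, Matrix.mul_apply]
  refine Finset.sum_congr rfl fun j _ => ?_
  rw [mul_diagonal, diagonal_mul, conjTranspose_apply]
  unfold overlap
  rw [← hK, Complex.normSq_eq_conj_mul_self]
  rw [RCLike.star_def]
  ring

/-- The rows of a unitary matrix are unit vectors, so a second eigenbasis can be summed in without
changing a trace. -/
theorem sum_overlap_right {U W : Matrix D D ℂ} (hU : U ∈ unitaryGroup D ℂ)
    (hW : W ∈ unitaryGroup D ℂ) (i : D) : ∑ j, overlap U W i j = 1 := by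
  have h1 : Uᴴ * U = 1 := mem_unitaryGroup_iff'.mp hU
  have h2 : W * Wᴴ = 1 := mem_unitaryGroup_iff.mp hW
  have h : (Uᴴ * W) * (Uᴴ * W)ᴴ = 1 := by
    rw [conjTranspose_mul, conjTranspose_conjTranspose, Matrix.mul_assoc, ← Matrix.mul_assoc W,
      h2, Matrix.one_mul, h1]
  have := congrFun (congrFun h i) i
  rw [Matrix.mul_apply, one_apply_eq] at this
  have h3 : ((∑ j, overlap U W i j : ℝ) : ℂ) = 1 := by
    rw [← this]
    push_cast
    refine Finset.sum_congr rfl fun j _ => ?_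
    rw [conjTranspose_apply, RCLike.star_def, Complex.mul_conj]
    rfl
  exact_mod_cast h3

theorem overlap_comm (U W : Matrix D D ℂ) (i j : D) : overlap U W i j = overlap W U j i := by
  have h : (Wᴴ * U) = (Uᴴ * W)ᴴ := by simp
  unfold overlap
  rw [h, conjTranspose_apply, RCLike.star_def, Complex.normSq_conj]

theorem sum_overlap_left {U W : Matrix D D ℂ} (hU : U ∈ unitaryGroup D ℂ)
    (hW : W ∈ unitaryGroup D ℂ) (j : D) : ∑ i, overlap U W i j = 1 := by
  simp_rw [overlap_comm U W]
  exact sum_overlap_right hW hU j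

theorem trace_diagConj {U : Matrix D D ℂ} (hU : U ∈ unitaryGroup D ℂ) (l : D → ℝ) :
    (diagConj U l).trace = ((∑ i, l i : ℝ) : ℂ) := by
  have h1 : Uᴴ * U = 1 := mem_unitaryGroup_iff'.mp hU
  unfold diagConj
  rw [trace_mul_comm, ← Matrix.mul_assoc, h1]
  simp [trace]

end DiagConj

/-! ### Block-diagonal matrices and their logarithms. -/

section DirectSum

variable {X d : Type*} [Fintype X] [DecidableEq X] [Fintype d] [DecidableEq d]

/-- The block-diagonal matrix `∑ x, |x⟩⟨x| ⊗ A x`. -/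
def directSum (A : X → Matrix d d ℂ) : Matrix (X × d) (X × d) ℂ :=
  of fun p q => if p.1 = q.1 then A p.1 p.2 q.2 else 0

theorem directSum_mul (A B : X → Matrix d d ℂ) :
    directSum A * directSum B = directSum fun x => A x * B x := by
  ext ⟨x, i⟩ ⟨y, j⟩
  simp only [directSum, Matrix.mul_apply, of_apply, Fintype.sum_prod_type]
  rw [Finset.sum_eq_single x]
  · by_cases h : x = y <;> simp [h]
  · intro z _ hz
    simp [Ne.symm hz]
  · simp

theorem directSum_conjTranspose (A : X → Matrix d d ℂ) :
    (directSum A)ᴴ = directSum fun x => (A x)ᴴ := by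
  ext ⟨x, i⟩ ⟨y, j⟩
  by_cases h : x = y
  · subst h; simp [directSum]
  · simp [directSum, h, Ne.symm h]

theorem directSum_diagonal (v : X → d → ℂ) :
    (directSum fun x => diagonal (v x)) = diagonal fun p : X × d => v p.1 p.2 := by
  ext ⟨x, i⟩ ⟨y, j⟩
  by_cases h : x = y
  · subst h
    by_cases h' : i = j
    · subst h'; simp [directSum]
    · simp [directSum, h']
  · simp [directSum, h]

theorem directSum_sub (A B : X → Matrix d d ℂ) :
    directSum A - directSum B = directSum fun x => A x - B x := by
  ext ⟨x, i⟩ ⟨y, j⟩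
  by_cases h : x = y <;> simp [directSum, h]

theorem directSum_one : directSum (fun _ : X => (1 : Matrix d d ℂ)) = 1 := by
  have := directSum_diagonal (fun (_ : X) (_ : d) => (1 : ℂ))
  simpa using this

theorem trace_directSum (A : X → Matrix d d ℂ) : (directSum A).trace = ∑ x, (A x).trace := by
  simp [trace, directSum, Fintype.sum_prod_type]

theorem ptraceFst_directSum (A : X → Matrix d d ℂ) : ptraceFst (directSum A) = ∑ x, A x := by
  ext i j
  simp [ptraceFst, directSum, Matrix.sum_apply]

theorem one_kronecker_eq_directSum (M : Matrix d d ℂ) :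
    (1 : Matrix X X ℂ) ⊗ₖ M = directSum fun _ => M := by
  ext ⟨x, i⟩ ⟨y, j⟩
  by_cases h : x = y <;> simp [directSum, h, kroneckerMap_apply]

theorem directSum_diagConj (U : X → Matrix d d ℂ) (l : X → d → ℝ) :
    (directSum fun x => diagConj (U x) (l x))
      = diagConj (directSum U) fun p : X × d => l p.1 p.2 := by
  unfold diagConj
  rw [← directSum_diagonal (fun x i => (l x i : ℂ)), directSum_conjTranspose, directSum_mul,
    directSum_mul]

theorem directSum_mem_unitaryGroup {U : X → Matrix d d ℂ} (hU : ∀ x, U x ∈ unitaryGroup d ℂ) :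
    directSum U ∈ unitaryGroup (X × d) ℂ := by
  rw [mem_unitaryGroup_iff, star_eq_conjTranspose, directSum_conjTranspose, directSum_mul,
    ← directSum_one]
  congr 1
  funext x
  exact mem_unitaryGroup_iff.mp (hU x)

theorem matLog_diagConj {U : Matrix d d ℂ} (hU : U ∈ unitaryGroup d ℂ) (l : d → ℝ) :
    matLog (diagConj U l) = diagConj U fun i => Real.logb 2 (l i) := cfc_diagConj hU l _

theorem matLog_directSum {U : X → Matrix d d ℂ} (hU : ∀ x, U x ∈ unitaryGroup d ℂ)
    (l : X → d → ℝ) :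
    matLog (directSum fun x => diagConj (U x) (l x))
      = directSum fun x => diagConj (U x) fun i => Real.logb 2 (l x i) := by
  rw [directSum_diagConj, matLog_diagConj (directSum_mem_unitaryGroup hU), directSum_diagConj]

end DirectSum

/-! ### Entropy and variance as moments of the log-ratio. -/

section Spectral

variable {X d : Type*} [Fintype X] [DecidableEq X] [Fintype d] [DecidableEq d]

/-- The weighted conditional states `p x • ρ x` of a classical-quantum state. -/
def CQState.weighted (S : CQState X d) (x : X) : Matrix d d ℂ := (S.p x : ℂ) • S.state x

theorem CQState.toMatrix_eq_directSum (S : CQState X d) :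
    S.toMatrix = directSum S.weighted := by
  ext ⟨x, i⟩ ⟨y, j⟩
  simp only [CQState.toMatrix, Matrix.sum_apply, directSum, of_apply, Matrix.smul_apply,
    kroneckerMap_apply, CQState.weighted]
  by_cases h : x = y
  · subst h
    rw [Finset.sum_eq_single x]
    · simp
    · intro z _ hz
      simp [hz]
    · simp
  · rw [if_neg h]
    refine Finset.sum_eq_zero fun z _ => ?_
    have : ¬ (z = x ∧ z = y) := fun hz => h (hz.1.symm.trans hz.2)
    simp [this]

/-- Spectral decompositions of the members of a family of positive semidefinite matrices and of
their sum. -/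
structure SpectralFamily (A : X → Matrix d d ℂ) where
  /-- Eigenbases of the members. -/
  U : X → Matrix d d ℂ
  /-- Eigenvalues of the members. -/
  l : X → d → ℝ
  /-- Eigenbasis of the sum. -/
  W : Matrix d d ℂ
  /-- Eigenvalues of the sum. -/
  m : d → ℝ
  U_mem : ∀ x, U x ∈ unitaryGroup d ℂ
  W_mem : W ∈ unitaryGroup d ℂ
  l_nonneg : ∀ x i, 0 ≤ l x i
  m_nonneg : ∀ j, 0 ≤ m j
  eq_diagConj : ∀ x, A x = diagConj (U x) (l x)
  sum_eq_diagConj : ∑ x, A x = diagConj W m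

theorem nonempty_spectralFamily {A : X → Matrix d d ℂ} (hA : ∀ x, (A x).PosSemidef) :
    Nonempty (SpectralFamily A) := by
  choose U hU l hl hAl using fun x => exists_eq_diagConj_of_posSemidef (hA x)
  obtain ⟨W, hW, m, hm, hB⟩ := exists_eq_diagConj_of_posSemidef
    (posSemidef_sum Finset.univ fun x _ => hA x)
  exact ⟨⟨U, l, W, m, hU, hW, hl, hm, hAl, hB⟩⟩

namespace SpectralFamily

variable {A : X → Matrix d d ℂ} (F : SpectralFamily A)

/-- The Nussbaum–Szkoła weights. -/
def weight (w : X × d × d) : ℝ := F.l w.1 w.2.1 * overlap (F.U w.1) F.W w.2.1 w.2.2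

/-- The difference of the logarithms of the eigenvalues of the sum and of a member. -/
noncomputable def logRatio (w : X × d × d) : ℝ := Real.logb 2 (F.m w.2.2) - Real.logb 2 (F.l w.1 w.2.1)

theorem weight_nonneg (w : X × d × d) : 0 ≤ F.weight w :=
  mul_nonneg (F.l_nonneg _ _) (overlap_nonneg _ _ _ _)

theorem trace_mul_diagConj (x : X) (f g : d → ℝ) :
    (diagConj (F.U x) f * diagConj F.W g).trace.re
      = ∑ i, ∑ j, f i * g j * overlap (F.U x) F.W i j := by
  rw [trace_diagConj_mul_diagConj, Complex.ofReal_re]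

theorem trace_diagConj_eq (x : X) (f : d → ℝ) :
    (diagConj (F.U x) f).trace.re = ∑ i, ∑ j, f i * overlap (F.U x) F.W i j := by
  rw [trace_diagConj (F.U_mem x), Complex.ofReal_re]
  refine Finset.sum_congr rfl fun i _ => ?_
  rw [← Finset.mul_sum, sum_overlap_right (F.U_mem x) F.W_mem, mul_one]

theorem matLog_eq : matLog (directSum A)
    = directSum fun x => diagConj (F.U x) fun i => Real.logb 2 (F.l x i) := by
  rw [← matLog_directSum F.U_mem]
  congr 2
  exact funext F.eq_diagConj

/-- `tr (B log B)` is expanded as `∑ x, tr (A x log B)`, so that both entropies become averages over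
the same weights. -/
theorem condEntropy_directSum :
    condEntropy (directSum A) = ∑ w, F.weight w * F.logRatio w := by
  have h1 : vonNeumannEntropy (directSum A)
      = -∑ x, ∑ i, ∑ j, F.l x i * Real.logb 2 (F.l x i) * overlap (F.U x) F.W i j := by
    unfold vonNeumannEntropy
    rw [F.matLog_eq, directSum_mul, trace_directSum, Complex.re_sum]
    congr 1
    refine Finset.sum_congr rfl fun x _ => ?_
    rw [F.eq_diagConj x, diagConj_mul (F.U_mem x), F.trace_diagConj_eq]
  have h2 : vonNeumannEntropy (ptraceFst (directSum A))
      = -∑ x, ∑ i, ∑ j, F.l x i * Real.logb 2 (F.m j) * overlap (F.U x) F.W i j := by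
    unfold vonNeumannEntropy
    rw [ptraceFst_directSum, F.sum_eq_diagConj, matLog_diagConj F.W_mem, ← F.sum_eq_diagConj,
      Finset.sum_mul, trace_sum, Complex.re_sum]
    congr 1
    refine Finset.sum_congr rfl fun x _ => ?_
    rw [F.eq_diagConj x, F.trace_mul_diagConj]
  unfold condEntropy
  rw [h1, h2]
  simp only [Fintype.sum_prod_type, weight, logRatio]
  rw [neg_sub_neg, ← Finset.sum_sub_distrib]
  refine Finset.sum_congr rfl fun x _ => ?_
  rw [← Finset.sum_sub_distrib]
  refine Finset.sum_congr rfl fun i _ => ?_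
  rw [← Finset.sum_sub_distrib]
  refine Finset.sum_congr rfl fun j _ => ?_
  ring

theorem relEntropy_directSum :
    relEntropy (directSum A) (directSum fun _ => ∑ x, A x) = -∑ w, F.weight w * F.logRatio w := by
  unfold relEntropy
  rw [F.sum_eq_diagConj, F.matLog_eq, matLog_directSum (fun _ => F.W_mem), directSum_sub, directSum_mul,
    trace_directSum, Complex.re_sum, Fintype.sum_prod_type, ← Finset.sum_neg_distrib]
  refine Finset.sum_congr rfl fun x _ => ?_
  rw [F.eq_diagConj x, Matrix.mul_sub, trace_sub, Complex.sub_re, diagConj_mul (F.U_mem x), F.trace_diagConj_eq,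
    F.trace_mul_diagConj, Fintype.sum_prod_type, ← Finset.sum_sub_distrib,
    ← Finset.sum_neg_distrib]
  refine Finset.sum_congr rfl fun i _ => ?_
  rw [← Finset.sum_sub_distrib, ← Finset.sum_neg_distrib]
  refine Finset.sum_congr rfl fun j _ => ?_
  simp only [weight, logRatio]
  ring

theorem condInfoVariance_directSum :
    condInfoVariance (directSum A)
      = ∑ w, F.weight w * F.logRatio w ^ 2 - (∑ w, F.weight w * F.logRatio w) ^ 2 := by
  unfold condInfoVariance relEntropyVariance
  rw [ptraceFst_directSum, one_kronecker_eq_directSum, F.relEntropy_directSum, neg_sq]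
  congr 1
  rw [F.sum_eq_diagConj, F.matLog_eq, matLog_directSum (fun _ => F.W_mem), directSum_sub, sq,
    directSum_mul, directSum_mul, trace_directSum, Complex.re_sum, Fintype.sum_prod_type]
  refine Finset.sum_congr rfl fun x _ => ?_
  rw [F.eq_diagConj x]
  set P := diagConj (F.U x) (F.l x) with hP
  set L := diagConj (F.U x) (fun i => Real.logb 2 (F.l x i)) with hL
  set M := diagConj F.W (fun i => Real.logb 2 (F.m i)) with hM
  -- `L` commutes with `P`, so by cyclicity every term of the square is the trace of a function of
  -- `A x` times a function of `B`. No ordering problem survives at second order.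
  have e : (P * ((L - M) * (L - M))).trace
      = (P * L * L).trace - (P * L * M).trace - (L * P * M).trace + (P * (M * M)).trace := by
    have h3 : (P * (M * L)).trace = (L * P * M).trace := by
      rw [← Matrix.mul_assoc, trace_mul_comm, Matrix.mul_assoc]
    rw [← h3]
    simp only [Matrix.mul_sub, Matrix.sub_mul, trace_sub, Matrix.mul_assoc]
    ring
  rw [e, Complex.add_re, Complex.sub_re, Complex.sub_re, hP, hL, hM, diagConj_mul (F.U_mem x),
    diagConj_mul (F.U_mem x), diagConj_mul (F.U_mem x), diagConj_mul F.W_mem, F.trace_diagConj_eq,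
    F.trace_mul_diagConj, F.trace_mul_diagConj, F.trace_mul_diagConj, Fintype.sum_prod_type,
    ← Finset.sum_sub_distrib, ← Finset.sum_sub_distrib, ← Finset.sum_add_distrib]
  refine Finset.sum_congr rfl fun i _ => ?_
  rw [← Finset.sum_sub_distrib, ← Finset.sum_sub_distrib, ← Finset.sum_add_distrib]
  refine Finset.sum_congr rfl fun j _ => ?_
  simp only [weight, logRatio]
  ring

end SpectralFamily

end Spectral

/-! ### Tensor products of matrices. -/

section TensorFamily

variable {d : Type*} [Fintype d] [DecidableEq d] {n : ℕ}

theorem tensorFamily_mul (A B : Fin n → Matrix d d ℂ) :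
    tensorFamily A * tensorFamily B = tensorFamily fun k => A k * B k := by
  ext i j
  simp only [tensorFamily, Matrix.mul_apply, of_apply, ← Finset.prod_mul_distrib]
  rw [Finset.prod_univ_sum, Fintype.piFinset_univ]

theorem tensorFamily_conjTranspose (A : Fin n → Matrix d d ℂ) :
    (tensorFamily A)ᴴ = tensorFamily fun k => (A k)ᴴ := by
  ext i j
  simp [tensorFamily]

theorem tensorFamily_diagonal (v : Fin n → d → ℂ) :
    (tensorFamily fun k => diagonal (v k)) = diagonal fun i => ∏ k, v k (i k) := by
  ext i j
  by_cases h : i = j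
  · subst h
    simp [tensorFamily]
  · rw [diagonal_apply_ne _ h]
    obtain ⟨k, hk⟩ := Function.ne_iff.mp h
    exact Finset.prod_eq_zero (Finset.mem_univ k) (diagonal_apply_ne _ hk)

theorem tensorFamily_one : (tensorFamily fun _ : Fin n => (1 : Matrix d d ℂ)) = 1 := by
  have := tensorFamily_diagonal (fun (_ : Fin n) (_ : d) => (1 : ℂ))
  simpa using this

theorem tensorFamily_mem_unitaryGroup {U : Fin n → Matrix d d ℂ}
    (hU : ∀ k, U k ∈ unitaryGroup d ℂ) : tensorFamily U ∈ unitaryGroup (Fin n → d) ℂ := by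
  rw [mem_unitaryGroup_iff, star_eq_conjTranspose, tensorFamily_conjTranspose, tensorFamily_mul,
    ← tensorFamily_one]
  congr 1
  funext k
  exact mem_unitaryGroup_iff.mp (hU k)

theorem tensorFamily_diagConj (U : Fin n → Matrix d d ℂ) (l : Fin n → d → ℝ) :
    (tensorFamily fun k => diagConj (U k) (l k))
      = diagConj (tensorFamily U) fun i => ∏ k, l k (i k) := by
  unfold diagConj
  push_cast
  rw [← tensorFamily_diagonal (fun k i => (l k i : ℂ)), tensorFamily_conjTranspose,
    tensorFamily_mul, tensorFamily_mul]

theorem tensorFamily_smul (c : Fin n → ℂ) (A : Fin n → Matrix d d ℂ) :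
    (tensorFamily fun k => c k • A k) = (∏ k, c k) • tensorFamily A := by
  ext i j
  simp [tensorFamily, Finset.prod_mul_distrib]

theorem sum_tensorFamily {X : Type*} [Fintype X] (A : X → Matrix d d ℂ) :
    ∑ x : Fin n → X, tensorFamily (fun k => A (x k)) = tensorFamily fun _ : Fin n => ∑ x, A x := by
  ext i j
  simp only [tensorFamily, Matrix.sum_apply, of_apply]
  rw [Finset.prod_univ_sum, Fintype.piFinset_univ]

theorem trace_tensorFamily (A : Fin n → Matrix d d ℂ) :
    (tensorFamily A).trace = ∏ k, (A k).trace := by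
  simp only [tensorFamily, trace, diag_apply, of_apply]
  rw [Finset.prod_univ_sum, Fintype.piFinset_univ]

theorem overlap_tensorFamily (U W : Fin n → Matrix d d ℂ) (i j : Fin n → d) :
    overlap (tensorFamily U) (tensorFamily W) i j = ∏ k, overlap (U k) (W k) (i k) (j k) := by
  unfold overlap
  rw [tensorFamily_conjTranspose, tensorFamily_mul]
  simp [tensorFamily, map_prod]

end TensorFamily

/-! ### Tensor powers of spectral data; the Petz and Neyman–Pearson quantities. -/

namespace SpectralFamily

variable {X d : Type*} [Fintype X] [DecidableEq X] [Fintype d] [DecidableEq d]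
variable {A : X → Matrix d d ℂ} (F : SpectralFamily A)

/-- The spectral decompositions of all `n`-fold tensor products of a family. -/
def tensorPower (n : ℕ) :
    SpectralFamily fun x : Fin n → X => tensorFamily fun k => A (x k) where
  U x := tensorFamily fun k => F.U (x k)
  l x i := ∏ k, F.l (x k) (i k)
  W := tensorFamily fun _ => F.W
  m j := ∏ k, F.m (j k)
  U_mem x := tensorFamily_mem_unitaryGroup fun k => F.U_mem (x k)
  W_mem := tensorFamily_mem_unitaryGroup fun _ => F.W_mem
  l_nonneg x i := Finset.prod_nonneg fun k _ => F.l_nonneg _ _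
  m_nonneg j := Finset.prod_nonneg fun k _ => F.m_nonneg _
  eq_diagConj x := by
    rw [← tensorFamily_diagConj]
    congr 1
    funext k
    exact F.eq_diagConj (x k)
  sum_eq_diagConj := by
    rw [sum_tensorFamily, F.sum_eq_diagConj, tensorFamily_diagConj]

/-- A sum over the index set of the tensor power, as a sum over words. -/
theorem sum_tensorPower_index {n : ℕ} (f : (Fin n → X) × (Fin n → d) × (Fin n → d) → ℝ) :
    ∑ w, f w = ∑ v : Fin n → X × d × d,
      f (fun k => (v k).1, fun k => (v k).2.1, fun k => (v k).2.2) := by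
  symm
  refine Fintype.sum_equiv
    { toFun := fun v : Fin n → X × d × d =>
        ((fun k => (v k).1, fun k => (v k).2.1, fun k => (v k).2.2) :
          (Fin n → X) × (Fin n → d) × (Fin n → d))
      invFun := fun w k => (w.1 k, w.2.1 k, w.2.2 k)
      left_inv := fun v => rfl
      right_inv := fun w => rfl } _ _ fun v => rfl

/-- A transition between an eigenvector of a member and a null vector of the sum has zero
weight. -/
theorem m_pos_of_weight_pos {w : X × d × d} (h : 0 < F.weight w) : 0 < F.m w.2.2 := by
  obtain ⟨x, i, j⟩ := w
  refine lt_of_le_of_ne (F.m_nonneg j) fun h0 => ?_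
  -- `Pi.single j 1` selects the projector onto `w_j`: the weights ending in `j` add up to `⟨w_j, B
  -- w_j⟩ = m_j = 0`, and they are nonnegative.
  have h1 : ∑ y, ∑ i, ∑ k, F.l y i * (Pi.single j 1 : d → ℝ) k * overlap (F.U y) F.W i k = 0 := by
    have e : ∀ y, ∑ i, ∑ k, F.l y i * (Pi.single j 1 : d → ℝ) k * overlap (F.U y) F.W i k
        = (A y * diagConj F.W (Pi.single j 1)).trace.re := fun y => by
      rw [F.eq_diagConj y, F.trace_mul_diagConj]
    simp_rw [e]
    rw [← Complex.re_sum, ← trace_sum, ← Finset.sum_mul, F.sum_eq_diagConj,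
      diagConj_mul F.W_mem, trace_diagConj F.W_mem, Complex.ofReal_re]
    refine Finset.sum_eq_zero fun k _ => ?_
    by_cases hk : k = j
    · subst hk; simp [← h0]
    · simp [hk]
  have hnn : ∀ y i k, 0 ≤ F.l y i * (Pi.single j 1 : d → ℝ) k * overlap (F.U y) F.W i k := by
    intro y i k
    refine mul_nonneg (mul_nonneg (F.l_nonneg _ _) ?_) (overlap_nonneg _ _ _ _)
    by_cases hk : k = j
    · subst hk; simp
    · simp [hk]
  rw [Finset.sum_eq_zero_iff_of_nonneg fun y _ => Finset.sum_nonneg fun i _ =>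
    Finset.sum_nonneg fun k _ => hnn y i k] at h1
  have h2 := h1 x (Finset.mem_univ x)
  rw [Finset.sum_eq_zero_iff_of_nonneg fun i _ => Finset.sum_nonneg fun k _ => hnn x i k] at h2
  have h3 := h2 i (Finset.mem_univ i)
  rw [Finset.sum_eq_zero_iff_of_nonneg fun k _ => hnn x i k] at h3
  have h4 := h3 j (Finset.mem_univ j)
  simp only [Pi.single_eq_same, mul_one] at h4
  exact h.ne' h4

theorem l_pos_of_weight_pos {w : X × d × d} (h : 0 < F.weight w) : 0 < F.l w.1 w.2.1 :=
  lt_of_le_of_ne (F.l_nonneg _ _) fun h0 => by simp [weight, ← h0] at h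

theorem sum_weight : ∑ w, F.weight w = (∑ x, A x).trace.re := by
  rw [trace_sum, Complex.re_sum, Fintype.sum_prod_type]
  refine Finset.sum_congr rfl fun x _ => ?_
  rw [F.eq_diagConj x, F.trace_diagConj_eq, Fintype.sum_prod_type]
  rfl

/-- The Petz quantity `∑ x, tr (A x)^(1-s) (∑ y, A y)^s`. -/
noncomputable def petz (s : ℝ) : ℝ :=
  ∑ x, ∑ i, ∑ j, F.l x i ^ (1 - s) * F.m j ^ s * overlap (F.U x) F.W i j

/-- Where the weight is positive, both eigenvalues are positive, so the convention `log 0 = 0` does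
no harm. Elsewhere either the overlap vanishes or `0 ^ (1 - s) = 0`, which needs `s < 1`. -/
theorem petz_eq {s : ℝ} (hs : s < 1) :
    F.petz s = ∑ w, F.weight w * (2 : ℝ) ^ (s * F.logRatio w) := by
  unfold petz
  simp only [Fintype.sum_prod_type]
  refine Finset.sum_congr rfl fun x _ => Finset.sum_congr rfl fun i _ =>
    Finset.sum_congr rfl fun j _ => ?_
  rcases (F.weight_nonneg (x, i, j)).eq_or_lt with h | h
  · rw [← h, zero_mul]
    rcases mul_eq_zero.mp h.symm with h' | h'
    · simp only at h'
      rw [h', Real.zero_rpow (by linarith)]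
      simp
    · simp only at h'
      rw [h', mul_zero]
  · have hl := F.l_pos_of_weight_pos h
    have hm := F.m_pos_of_weight_pos h
    simp only at hl hm
    have e : (2 : ℝ) ^ (s * F.logRatio (x, i, j)) = F.m j ^ s * F.l x i ^ (-s) := by
      unfold logRatio
      simp only
      rw [mul_sub, Real.rpow_sub two_pos, mul_comm s, mul_comm s, Real.rpow_mul zero_le_two,
        Real.rpow_mul zero_le_two, Real.rpow_logb two_pos (by norm_num) hm,
        Real.rpow_logb two_pos (by norm_num) hl, Real.rpow_neg hl.le, div_eq_mul_inv]
    rw [e, weight]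
    simp only
    rw [sub_eq_add_neg, Real.rpow_add hl, Real.rpow_one]
    ring

/-- Eigenvalues and overlaps of tensor products are products, so the bound on the error becomes
single-letter. -/
theorem petz_tensorPower (n : ℕ) (s : ℝ) : (F.tensorPower n).petz s = F.petz s ^ n := by
  unfold petz
  have e1 : ∑ x, ∑ i, ∑ j, F.l x i ^ (1 - s) * F.m j ^ s * overlap (F.U x) F.W i j
      = ∑ w : X × d × d, F.l w.1 w.2.1 ^ (1 - s) * F.m w.2.2 ^ s
          * overlap (F.U w.1) F.W w.2.1 w.2.2 := by
    simp only [Fintype.sum_prod_type]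
  have e2 : ∑ x, ∑ i, ∑ j, (F.tensorPower n).l x i ^ (1 - s) * (F.tensorPower n).m j ^ s
        * overlap ((F.tensorPower n).U x) (F.tensorPower n).W i j
      = ∑ w : (Fin n → X) × (Fin n → d) × (Fin n → d),
          (F.tensorPower n).l w.1 w.2.1 ^ (1 - s) * (F.tensorPower n).m w.2.2 ^ s
          * overlap ((F.tensorPower n).U w.1) (F.tensorPower n).W w.2.1 w.2.2 := by
    simp only [Fintype.sum_prod_type]
  rw [e1, e2, sum_tensorPower_index, Fintype.sum_pow]
  refine Finset.sum_congr rfl fun v _ => ?_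
  simp only [tensorPower]
  rw [overlap_tensorFamily, ← Real.finsetProd_rpow _ _ fun k _ => F.l_nonneg _ _,
    ← Real.finsetProd_rpow _ _ fun k _ => F.m_nonneg _, ← Finset.prod_mul_distrib,
    ← Finset.prod_mul_distrib]

/-- This is the independence of the `n` coordinates. -/
theorem weight_tensorPower {n : ℕ} (v : Fin n → X × d × d) :
    (F.tensorPower n).weight (fun k => (v k).1, fun k => (v k).2.1, fun k => (v k).2.2)
      = ∏ k, F.weight (v k) := by
  simp only [weight, tensorPower]
  rw [overlap_tensorFamily, ← Finset.prod_mul_distrib]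

/-- The Neyman–Pearson quantity `∑ min (λ, c μ)` over the Nussbaum–Szkoła pairs. -/
def minSum (c : ℝ) : ℝ :=
  ∑ w : X × d × d, min (F.l w.1 w.2.1) (c * F.m w.2.2) * overlap (F.U w.1) F.W w.2.1 w.2.2

/-- The Neyman–Pearson quantity of a tensor power is at least a tail probability of the sum of
independent log-ratios. -/
theorem tail_le_minSum_tensorPower (n : ℕ) (t : ℝ) :
    ∑ v : Fin n → X × d × d with t ≤ ∑ k, F.logRatio (v k), ∏ k, F.weight (v k)
      ≤ (F.tensorPower n).minSum ((2 : ℝ) ^ (-t)) := by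
  unfold minSum
  rw [sum_tensorPower_index]
  have hnn : ∀ v : Fin n → X × d × d,
      0 ≤ min ((F.tensorPower n).l (fun k => (v k).1) fun k => (v k).2.1)
        ((2 : ℝ) ^ (-t) * (F.tensorPower n).m fun k => (v k).2.2)
        * overlap ((F.tensorPower n).U fun k => (v k).1) (F.tensorPower n).W
          (fun k => (v k).2.1) (fun k => (v k).2.2) := fun v =>
    mul_nonneg (le_min ((F.tensorPower n).l_nonneg _ _) (mul_nonneg (by positivity)
      ((F.tensorPower n).m_nonneg _))) (overlap_nonneg _ _ _ _)
  refine (Finset.sum_le_sum fun v hv => ?_).trans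
    (Finset.sum_le_sum_of_subset_of_nonneg (Finset.filter_subset _ _) fun v _ _ => ?_)
  · rw [Finset.mem_filter] at hv
    -- If all weights are positive, the tail condition gives `2 ^ (-t) * m ≥ λ` for the product
    -- eigenvalues, so the minimum is `λ` and the term is the full weight. Otherwise the left term
    -- is zero.
    by_cases h : ∀ k, 0 < F.weight (v k)
    · have hl := fun k => F.l_pos_of_weight_pos (h k)
      have hm := fun k => F.m_pos_of_weight_pos (h k)
      have e : ∀ k, F.m (v k).2.2 = F.l (v k).1 (v k).2.1 * 2 ^ F.logRatio (v k) := fun k => by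
        unfold logRatio
        rw [Real.rpow_sub two_pos, Real.rpow_logb two_pos (by norm_num) (hm k),
          Real.rpow_logb two_pos (by norm_num) (hl k)]
        field_simp [(hl k).ne']
      rw [← F.weight_tensorPower, weight]
      refine mul_le_mul_of_nonneg_right (le_min le_rfl ?_) (overlap_nonneg _ _ _ _)
      simp only [tensorPower]
      simp_rw [e]
      rw [Finset.prod_mul_distrib, ← Real.rpow_sum_of_pos two_pos, mul_left_comm,
        ← Real.rpow_add two_pos]
      exact le_mul_of_one_le_right (Finset.prod_nonneg fun k _ => (hl k).le)
        (Real.one_le_rpow one_le_two (by linarith [hv.2]))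
    · push Not at h
      obtain ⟨k, hk⟩ := h
      rw [Finset.prod_eq_zero (Finset.mem_univ k) (hk.antisymm (F.weight_nonneg _))]
      exact hnn v
  · exact hnn v

end SpectralFamily

/-! ### Audenaert's and Hayashi–Nagaoka's inequalities. -/

section OperatorInequalities

open scoped Matrix.Norms.L2Operator MatrixOrder

variable {D : Type*} [Fintype D] [DecidableEq D]

theorem trace_mul_re_nonneg {A B : Matrix D D ℂ} (hA : 0 ≤ A) (hB : 0 ≤ B) :
    0 ≤ (A * B).trace.re := by
  obtain ⟨U, -, l, hl, rfl⟩ := exists_eq_diagConj_of_posSemidef (nonneg_iff_posSemidef.mp hA)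
  obtain ⟨W, -, m, hm, rfl⟩ := exists_eq_diagConj_of_posSemidef (nonneg_iff_posSemidef.mp hB)
  rw [trace_diagConj_mul_diagConj, Complex.ofReal_re]
  exact Finset.sum_nonneg fun i _ => Finset.sum_nonneg fun j _ =>
    mul_nonneg (mul_nonneg (hl i) (hm j)) (overlap_nonneg _ _ _ _)

theorem trace_mul_re_le_left {A B C : Matrix D D ℂ} (hC : 0 ≤ C) (h : A ≤ B) :
    (C * A).trace.re ≤ (C * B).trace.re := by
  have := trace_mul_re_nonneg hC (sub_nonneg.mpr h)
  rw [Matrix.mul_sub, trace_sub, Complex.sub_re] at this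
  linarith

theorem trace_mul_re_le_right {A B C : Matrix D D ℂ} (hC : 0 ≤ C) (h : A ≤ B) :
    (A * C).trace.re ≤ (B * C).trace.re := by
  rw [trace_mul_comm, trace_mul_comm B]
  exact trace_mul_re_le_left hC h

theorem diagConj_nonneg (U : Matrix D D ℂ) {l : D → ℝ} (hl : ∀ i, 0 ≤ l i) :
    0 ≤ diagConj U l :=
  nonneg_iff_posSemidef.mpr (diagConj_posSemidef U hl)

theorem diagConj_mono (U : Matrix D D ℂ) {l m : D → ℝ} (h : ∀ i, l i ≤ m i) :
    diagConj U l ≤ diagConj U m := by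
  have e : m = fun i => l i + (m i - l i) := by simp
  rw [e, diagConj_add]
  exact le_add_of_nonneg_right (diagConj_nonneg U fun i => sub_nonneg.mpr (h i))

theorem le_of_diagConj_le {U : Matrix D D ℂ} (hU : U ∈ unitaryGroup D ℂ) {l m : D → ℝ}
    (h : diagConj U l ≤ diagConj U m) (i : D) : l i ≤ m i := by
  have e : m = fun i => l i + (m i - l i) := by simp
  rw [e, diagConj_add, le_add_iff_nonneg_right, nonneg_iff_posSemidef] at h
  have h1 := h.conjTranspose_mul_mul_same U
  rw [conjTranspose_mul_diagConj_mul hU, posSemidef_diagonal_iff] at h1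
  have h2 := h1 i
  rw [Complex.zero_le_real] at h2
  linarith

/-- Operator monotonicity of `t ↦ t ^ s`. -/
theorem diagConj_rpow_mono {U W : Matrix D D ℂ} (hU : U ∈ unitaryGroup D ℂ)
    (hW : W ∈ unitaryGroup D ℂ) {l m : D → ℝ} (hl : ∀ i, 0 ≤ l i) (hm : ∀ i, 0 ≤ m i)
    (h : diagConj U l ≤ diagConj W m) {s : ℝ} (hs0 : 0 ≤ s) (hs1 : s ≤ 1) :
    diagConj U (fun i => l i ^ s) ≤ diagConj W (fun i => m i ^ s) := by
  have e : ∀ {U : Matrix D D ℂ} {l : D → ℝ}, U ∈ unitaryGroup D ℂ → (∀ i, 0 ≤ l i) →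
      diagConj U (fun i => l i ^ s) = diagConj U l ^ s := fun hU hl => by
    rw [CFC.rpow_eq_cfc_real (ha := diagConj_nonneg _ hl), cfc_diagConj hU]
  rw [e hU hl, e hW hm]
  exact CFC.rpow_le_rpow ⟨hs0, hs1⟩ h

/-- **Audenaert's inequality**, in the form of the existence of a test. -/
theorem exists_test_le_petz {U W : Matrix D D ℂ} (hU : U ∈ unitaryGroup D ℂ)
    (hW : W ∈ unitaryGroup D ℂ) {l m : D → ℝ} (hl : ∀ i, 0 ≤ l i) (hm : ∀ i, 0 ≤ m i)
    {s : ℝ} (hs0 : 0 < s) (hs1 : s < 1) :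
    ∃ T : Matrix D D ℂ, 0 ≤ T ∧ T ≤ 1 ∧
      (diagConj U l * (1 - T)).trace.re + (diagConj W m * T).trace.re
        ≤ ∑ i, ∑ j, l i ^ (1 - s) * m j ^ s * overlap U W i j := by
  set A := diagConj U l with hA
  set B := diagConj W m with hB
  obtain ⟨V, hV, k, hk⟩ := exists_eq_diagConj ((diagConj_isHermitian U l).sub
    (diagConj_isHermitian W m))
  rw [← hA, ← hB] at hk
  -- `T` is the Neyman–Pearson projector onto the positive part `P` of `A - B`.
  set T := diagConj V (fun i => if 0 < k i then (1 : ℝ) else 0) with hT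
  set P := diagConj V (fun i => max (k i) 0) with hP
  have one_eq : diagConj V (fun _ => (1 : ℝ)) = 1 := by simp [diagConj_const hV]
  refine ⟨T, diagConj_nonneg V fun i => ?_, ?_, ?_⟩
  · split_ifs <;> norm_num
  · rw [← one_eq]
    refine diagConj_mono V fun i => ?_
    split_ifs <;> norm_num
  have hAP : A - B ≤ P := by
    rw [hk]
    exact diagConj_mono V fun i => le_max_left _ _
  have hP0 : 0 ≤ P := diagConj_nonneg V fun i => le_max_right _ _
  have hB0 : 0 ≤ B := diagConj_nonneg W hm
  have hTP : ((A - B) * T).trace = P.trace := by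
    rw [hk, diagConj_mul hV]
    congr 2
    funext i
    split_ifs with h
    · rw [mul_one, max_eq_left h.le]
    · rw [mul_zero, max_eq_right (not_lt.mp h)]
  -- `C = B + P` dominates both `A` and `B`. Operator monotonicity then gives `tr A - tr A^{1-s} B^s
  -- ≤ tr A^{1-s}(C^s - B^s) ≤ tr C^{1-s}(C^s - B^s) ≤ tr C - tr B = tr P`, and `tr P = tr (A - B)
  -- T`.
  obtain ⟨Z, hZ, c, hc, hC⟩ := exists_eq_diagConj_of_posSemidef
    (nonneg_iff_posSemidef.mp (add_nonneg hB0 hP0))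
  have hAC : A ≤ diagConj Z c := by rw [← hC]; exact sub_le_iff_le_add'.mp hAP
  have hBC : B ≤ diagConj Z c := by rw [← hC]; exact le_add_of_nonneg_right hP0
  have hs1' : 0 ≤ 1 - s := by linarith
  have hAC1 := diagConj_rpow_mono hU hZ hl hc hAC hs1' (by linarith)
  have hBC1 := diagConj_rpow_mono hW hZ hm hc hBC hs1' (by linarith)
  have hACs := diagConj_rpow_mono hU hZ hl hc hAC hs0.le hs1.le
  have hBCs := diagConj_rpow_mono hW hZ hm hc hBC hs0.le hs1.le
  have split : ∀ {U : Matrix D D ℂ} {l : D → ℝ}, U ∈ unitaryGroup D ℂ → (∀ i, 0 ≤ l i) →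
      diagConj U (fun i => l i ^ (1 - s)) * diagConj U (fun i => l i ^ s) = diagConj U l := by
    intro U l hU hl
    rw [diagConj_mul hU]
    congr 1
    funext i
    rw [← Real.rpow_add_of_nonneg (hl i) hs1' hs0.le]
    simp
  have step1 := trace_mul_re_le_left
    (diagConj_nonneg U fun i => Real.rpow_nonneg (hl i) (1 - s)) hACs
  have step2 := trace_mul_re_le_right (sub_nonneg.mpr hBCs) hAC1
  have step3 := trace_mul_re_le_right
    (diagConj_nonneg W fun i => Real.rpow_nonneg (hm i) s) hBC1
  simp only [Matrix.mul_sub, trace_sub, Complex.sub_re] at step2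
  rw [split hU hl] at step1
  rw [split hZ hc] at step2
  rw [split hW hm] at step3
  have hpetz : (diagConj U (fun i => l i ^ (1 - s)) * diagConj W (fun i => m i ^ s)).trace.re
      = ∑ i, ∑ j, l i ^ (1 - s) * m j ^ s * overlap U W i j := by
    rw [trace_diagConj_mul_diagConj, Complex.ofReal_re]
  have hCt : (diagConj Z c).trace.re = B.trace.re + P.trace.re := by
    rw [← hC, trace_add, Complex.add_re]
  have hTP' := congrArg Complex.re hTP
  rw [Matrix.sub_mul, trace_sub, Complex.sub_re] at hTP'
  rw [Matrix.mul_sub, Matrix.mul_one, trace_sub, Complex.sub_re, ← hpetz]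
  linarith

/-- The **Hayashi–Nagaoka inequality**, with the square-root measurement regularized by `η`. -/
theorem exists_hayashiNagaoka {C : Matrix D D ℂ} {η : ℝ} (hη : 0 < η)
    (hC : (η : ℂ) • (1 : Matrix D D ℂ) ≤ C) :
    ∃ G : Matrix D D ℂ, G.IsHermitian ∧ G * C * G = 1 ∧
      ∀ S : Matrix D D ℂ, 0 ≤ S → S ≤ 1 → S ≤ C →
        1 - G * S * G ≤ (2 : ℂ) • (1 - S) + (4 : ℂ) • (C - S) := by
  have hη0 : 0 ≤ (η : ℂ) • (1 : Matrix D D ℂ) := by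
    rw [nonneg_iff_posSemidef]
    exact PosSemidef.one.smul (by simpa using hη.le)
  obtain ⟨V, hV, k, hk0, rfl⟩ := exists_eq_diagConj_of_posSemidef
    (nonneg_iff_posSemidef.mp (hη0.trans hC))
  have hk : ∀ i, 0 < k i := fun i => by
    rw [← diagConj_const hV] at hC
    exact hη.trans_le (le_of_diagConj_le hV hC i)
  have one_eq : diagConj V (fun _ => (1 : ℝ)) = 1 := by simp [diagConj_const hV]
  set G := diagConj V (fun i => (k i ^ (1 / 2 : ℝ))⁻¹) with hG
  set R := diagConj V (fun i => k i ^ (1 / 2 : ℝ)) with hR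
  set C := diagConj V k with hCdef
  have hkk : ∀ i, k i ^ (1 / 2 : ℝ) * k i ^ (1 / 2 : ℝ) = k i := fun i => by
    rw [← Real.rpow_add (hk i)]; norm_num
  have hRR : C = R * R := by
    rw [hR, diagConj_mul hV, hCdef]
    simp_rw [hkk]
  have hne : ∀ i, k i ^ (1 / 2 : ℝ) ≠ 0 := fun i => (Real.rpow_pos_of_pos (hk i) _).ne'
  have hGR : G * R = 1 := by
    rw [hR, hG, diagConj_mul hV, ← one_eq]
    simp_rw [inv_mul_cancel₀ (hne _)]
  have hRG : R * G = 1 := by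
    rw [hR, hG, diagConj_mul hV, ← one_eq]
    simp_rw [mul_inv_cancel₀ (hne _)]
  have hGH : G.IsHermitian := diagConj_isHermitian _ _
  have hGC : G * C = R := by rw [hRR, ← Matrix.mul_assoc, hGR, Matrix.one_mul]
  have hCG : C * G = R := by rw [hRR, Matrix.mul_assoc, hRG, Matrix.mul_one]
  have hGCG : G * C * G = 1 := by rw [hGC, hRG]
  refine ⟨G, hGH, hGCG, fun S hS0 hS1 hSC => ?_⟩
  -- `S ≤ S^{1/2}` since `S ≤ 1`, and `S^{1/2} ≤ C^{1/2}` since `S ≤ C`.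
  have hSR : S ≤ R := by
    obtain ⟨U, hU, l, hl, rfl⟩ := exists_eq_diagConj_of_posSemidef
      (nonneg_iff_posSemidef.mp hS0)
    have hl1 : ∀ i, l i ≤ 1 := by
      have : (1 : Matrix D D ℂ) = diagConj U (fun _ => 1) := by simp [diagConj_const hU]
      rw [this] at hS1
      exact le_of_diagConj_le hU hS1
    refine le_trans (diagConj_mono U fun i => ?_)
      (diagConj_rpow_mono hU hV hl hk0 hSC (by norm_num : (0 : ℝ) ≤ 1 / 2) (by norm_num))
    simpa using Real.rpow_le_rpow_of_exponent_ge' (hl i) (hl1 i)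
      (by norm_num : (0 : ℝ) ≤ 1 / 2) (by norm_num : (1 / 2 : ℝ) ≤ 1)
  have conj_nonneg : ∀ {K Q : Matrix D D ℂ}, K.IsHermitian → 0 ≤ Q → 0 ≤ K * Q * K := by
    intro K Q hK hQ
    have := (nonneg_iff_posSemidef.mp hQ).mul_mul_conjTranspose_same K
    rw [hK.eq] at this
    exact nonneg_iff_posSemidef.mpr this
  have hT0 : 0 ≤ C - S := sub_nonneg.mpr hSC
  have h2 : 0 ≤ (G - 2) * (C - S) * (G - 2) := by
    refine conj_nonneg ?_ hT0
    have : ((2 : Matrix D D ℂ)).IsHermitian := by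
      have e : (2 : Matrix D D ℂ) = 1 + 1 := by norm_num
      rw [e]; exact isHermitian_one.add isHermitian_one
    exact hGH.sub this
  have h1 : 0 ≤ (G - 1) * S * (G - 1) := conj_nonneg (hGH.sub isHermitian_one) hS0
  -- With `G = C^{-1/2}` and `R = C^{1/2}`, the difference of the two sides is written as a sum of
  -- visibly positive terms.
  have key : (2 : ℂ) • (1 - S) + (4 : ℂ) • (C - S) - (1 - G * S * G)
      = (G - 2) * (C - S) * (G - 2) + (2 : ℂ) • ((G - 1) * S * (G - 1)) + (4 : ℂ) • (R - S) := by
    have e1 : (G - 2) * (C - S) * (G - 2)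
        = 1 - G * S * G - (2 : ℂ) • (R + R - G * S - S * G) + (4 : ℂ) • (C - S) := by
      have e2 : (2 : Matrix D D ℂ) = (2 : ℂ) • 1 := by
        ext i j; simp [Matrix.one_apply, Matrix.ofNat_apply]
      rw [e2]
      simp only [Matrix.mul_sub, Matrix.sub_mul, hGC, hRG, hCG, Matrix.mul_smul, Matrix.smul_mul,
        Matrix.mul_one, Matrix.one_mul]
      module
    have e3 : (G - 1) * S * (G - 1) = G * S * G - G * S - S * G + S := by
      simp only [Matrix.mul_sub, Matrix.sub_mul, Matrix.mul_one, Matrix.one_mul]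
      abel
    rw [e1, e3]
    module
  rw [← sub_nonneg, key]
  have smul_nn : ∀ {Q : Matrix D D ℂ} {c : ℝ}, 0 ≤ c → 0 ≤ Q → 0 ≤ (c : ℂ) • Q := by
    intro Q c hc hQ
    exact nonneg_iff_posSemidef.mpr ((nonneg_iff_posSemidef.mp hQ).smul (by simpa using hc))
  refine add_nonneg (add_nonneg h2 ?_) ?_
  · exact_mod_cast smul_nn zero_le_two h1
  · exact_mod_cast smul_nn zero_le_four (sub_nonneg.mpr hSR)

end OperatorInequalities

/-! ### Random binning and the one-shot achievability bound. -/

section RandomBinning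

open scoped Matrix.Norms.L2Operator MatrixOrder

variable {X D : Type*} [Fintype X] [DecidableEq X] [Fintype D] [DecidableEq D]

/-- Square-root decoding of a binning: the loss of each letter is controlled by its own test and
the tests of the other letters in its bin. -/
theorem exists_decoder {ι : Type*} [DecidableEq ι] [Nonempty X] (enc : X → ι)
    {T : X → Matrix D D ℂ} (hT0 : ∀ x, 0 ≤ T x) (hT1 : ∀ x, T x ≤ 1) {η : ℝ} (hη : 0 < η) :
    ∃ dec : ι → X → Matrix D D ℂ, (∀ w x, 0 ≤ dec w x) ∧ (∀ w, ∑ x, dec w x = 1) ∧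
      ∀ x, 1 - dec (enc x) x ≤ (2 : ℂ) • (1 - T x) + (4 : ℂ) • ((η : ℂ) • (1 : Matrix D D ℂ)
        + ∑ y, if y ≠ x ∧ enc y = enc x then T y else 0) := by
  have hη0 : 0 ≤ (η : ℂ) • (1 : Matrix D D ℂ) := by
    rw [nonneg_iff_posSemidef]
    exact PosSemidef.one.smul (by simpa using hη.le)
  set S : ι → Matrix D D ℂ := fun w => ∑ y, if enc y = w then T y else 0 with hS
  have hite : ∀ (p : Prop) [Decidable p] y, 0 ≤ (if p then T y else 0) := fun p _ y => by
    split_ifs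
    · exact hT0 y
    · exact le_rfl
  have hS0 : ∀ w, 0 ≤ S w := fun w => Finset.sum_nonneg fun y _ => hite _ y
  choose G hGH hG1 hG using fun w => exists_hayashiNagaoka hη
    (C := (η : ℂ) • (1 : Matrix D D ℂ) + S w) (le_add_of_nonneg_right (hS0 w))
  have conj_nonneg : ∀ {w} {Q : Matrix D D ℂ}, 0 ≤ Q → 0 ≤ G w * Q * G w := by
    intro w Q hQ
    have := (nonneg_iff_posSemidef.mp hQ).mul_mul_conjTranspose_same (G w)
    rw [(hGH w).eq] at this
    exact nonneg_iff_posSemidef.mpr this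
  let x₀ : X := Classical.arbitrary X
  -- The regularized elements of a bin add up to `1 - η G²`; the missing `η G²` is given to an
  -- arbitrary letter `x₀`, which only enlarges that element.
  refine ⟨fun w x => G w * (if enc x = w then T x else 0) * G w
    + if x = x₀ then G w * ((η : ℂ) • 1) * G w else 0, fun w x => ?_, fun w => ?_, fun x => ?_⟩
  · refine add_nonneg (conj_nonneg (hite _ x)) ?_
    split_ifs
    · exact conj_nonneg hη0
    · exact le_rfl
  · rw [Finset.sum_add_distrib, ← Finset.sum_mul, ← Finset.mul_sum, Finset.sum_ite_eq',
      if_pos (Finset.mem_univ _), ← Matrix.add_mul, ← Matrix.mul_add, add_comm (∑ y, _)]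
    exact hG1 w
  · have hsplit : S (enc x) = T x + ∑ y, if y ≠ x ∧ enc y = enc x then T y else 0 := by
      have : T x = ∑ y, if y = x then T y else 0 := by simp
      rw [hS]
      simp only
      rw [this, ← Finset.sum_add_distrib]
      refine Finset.sum_congr rfl fun y _ => ?_
      by_cases h : y = x
      · subst h; simp
      · simp [h]
    have hle : T x ≤ (η : ℂ) • (1 : Matrix D D ℂ) + S (enc x) := by
      rw [hsplit]
      exact le_add_of_nonneg_of_le hη0 (le_add_of_nonneg_right
        (Finset.sum_nonneg fun y _ => hite _ y))
    have := hG (enc x) (T x) (hT0 x) (hT1 x) hle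
    refine le_trans ?_ (this.trans_eq ?_)
    · simp only [if_true]
      rw [← sub_sub]
      refine sub_le_self _ ?_
      split_ifs
      · exact conj_nonneg hη0
      · exact le_rfl
    · rw [hsplit]
      congr 2
      abel

/-- Two distinct letters are in the same bin for a fraction `1 / M` of all binnings. -/
theorem sum_ite_enc_eq {M : ℕ} [NeZero M] {x y : X} (h : y ≠ x) :
    ∑ enc : X → Fin M, (if enc y = enc x then (1 : ℝ) else 0)
      = (∑ _enc : X → Fin M, (1 : ℝ)) / M := by
  have hM : (M : ℝ) ≠ 0 := NeZero.ne _
  rw [eq_div_iff hM]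
  -- Translating the value `enc y` by `c` permutes the binnings, so all values of `enc x - enc y`
  -- are equally frequent.
  have h1 : ∀ c : Fin M, ∑ enc : X → Fin M, (if enc y = enc x then (1 : ℝ) else 0)
      = ∑ enc : X → Fin M, if c = enc x - enc y then (1 : ℝ) else 0 := by
    intro c
    symm
    refine Fintype.sum_equiv (Equiv.addRight (Pi.single y c)) _ _ fun enc => ?_
    have : (c = enc x - enc y) ↔ (enc y + c = enc x) := by
      rw [eq_sub_iff_add_eq, add_comm]
    simp [this, h.symm]
  have h2 : (∑ enc : X → Fin M, (if enc y = enc x then (1 : ℝ) else 0)) * M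
      = ∑ c : Fin M, ∑ enc : X → Fin M, if c = enc x - enc y then (1 : ℝ) else 0 := by
    simp_rw [← h1]
    simp [mul_comm]
  rw [h2, Finset.sum_comm]
  simp

/-- One-shot achievability for classical data compression with quantum side information. -/
theorem SpectralFamily.exists_code {A : X → Matrix D D ℂ} (F : SpectralFamily A) [Nonempty X]
    {M : ℕ} (hM : 0 < M) {s : ℝ} (hs0 : 0 < s) (hs1 : s < 1) {η : ℝ} (hη : 0 < η) :
    ∃ (enc : X → Fin M) (dec : Fin M → X → Matrix D D ℂ),
      (∀ w x, (dec w x).PosSemidef) ∧ (∀ w, ∑ x, dec w x = 1) ∧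
      ∑ x, (A x).trace.re - ∑ x, (dec (enc x) x * A x).trace.re
        ≤ 4 * ((M : ℝ) ^ (-s) * F.petz s) + 4 * η * ∑ x, (A x).trace.re := by
  have : NeZero M := ⟨hM.ne'⟩
  have hM' : (0 : ℝ) < M := Nat.cast_pos.mpr hM
  -- The alternative is `B / M` because a wrong letter falls into the bin of `x` with probability `1
  -- / M`.
  choose T hT0 hT1 hT using fun x => exists_test_le_petz (F.U_mem x) F.W_mem (F.l_nonneg x)
    (m := fun j => (M : ℝ)⁻¹ * F.m j) (fun j => mul_nonneg (inv_nonneg.mpr hM'.le) (F.m_nonneg j))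
    hs0 hs1
  choose dec hdec0 hdec1 hdec using fun enc : X → Fin M => exists_decoder enc hT0 hT1 hη
  have hA0 : ∀ x, 0 ≤ A x := fun x => by
    rw [F.eq_diagConj x]; exact diagConj_nonneg _ (F.l_nonneg x)
  set a : X → ℝ := fun x => (A x * (1 - T x)).trace.re with ha
  set b : X → X → ℝ := fun x y => (A x * T y).trace.re with hb
  have hb0 : ∀ x y, 0 ≤ b x y := fun x y => trace_mul_re_nonneg (hA0 x) (hT0 y)
  have hloss : ∀ (enc : X → Fin M) (x : X),
      (A x).trace.re - (dec enc (enc x) x * A x).trace.re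
        ≤ 2 * a x + 4 * (η * (A x).trace.re
          + ∑ y, if y ≠ x then (if enc y = enc x then 1 else 0) * b x y else 0) := by
    intro enc x
    have h1 := trace_mul_re_le_left (hA0 x) (hdec enc x)
    rw [Matrix.mul_sub, Matrix.mul_one, trace_sub, Complex.sub_re, trace_mul_comm] at h1
    refine h1.trans_eq ?_
    have h4 : (4 : ℂ) = ((4 : ℝ) : ℂ) := by norm_num
    have h2 : (2 : ℂ) = ((2 : ℝ) : ℂ) := by norm_num
    rw [Matrix.mul_add, trace_add, Complex.add_re, Matrix.mul_smul, trace_smul, Matrix.mul_smul,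
      trace_smul, Matrix.mul_add, Matrix.mul_smul, trace_add, trace_smul, Matrix.mul_one,
      Finset.mul_sum, trace_sum, h2, h4, smul_eq_mul, smul_eq_mul, smul_eq_mul,
      Complex.re_ofReal_mul, Complex.re_ofReal_mul, Complex.add_re, Complex.re_ofReal_mul,
      Complex.re_sum]
    congr 4
    funext y
    by_cases h : y = x <;> by_cases h' : enc y = enc x <;> simp [h, h', hb]
  set N : ℝ := ∑ _enc : X → Fin M, (1 : ℝ) with hN
  have havg : ∑ enc : X → Fin M, ∑ x, (2 * a x + 4 * (η * (A x).trace.re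
        + ∑ y, if y ≠ x then (if enc y = enc x then 1 else 0) * b x y else 0))
      ≤ ∑ _enc : X → Fin M,
        (4 * ((M : ℝ) ^ (-s) * F.petz s) + 4 * η * ∑ x, (A x).trace.re) := by
    have e1 : ∑ enc : X → Fin M, ∑ x, (2 * a x + 4 * (η * (A x).trace.re
        + ∑ y, if y ≠ x then (if enc y = enc x then 1 else 0) * b x y else 0))
        = N * (∑ x, (2 * a x + 4 * (η * (A x).trace.re
          + ∑ y, if y ≠ x then (M : ℝ)⁻¹ * b x y else 0))) := by
      rw [Finset.sum_comm, Finset.mul_sum]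
      refine Finset.sum_congr rfl fun x _ => ?_
      have c : ∀ r : ℝ, ∑ _enc : X → Fin M, r = N * r := fun r => by
        rw [hN, Finset.sum_mul, one_mul]
      have e5 : ∑ enc : X → Fin M,
          ∑ y, (if y ≠ x then (if enc y = enc x then 1 else 0) * b x y else 0)
          = N * ∑ y, if y ≠ x then (M : ℝ)⁻¹ * b x y else 0 := by
        rw [Finset.sum_comm, Finset.mul_sum]
        refine Finset.sum_congr rfl fun y _ => ?_
        by_cases h : y = x
        · simp [h]
        · simp only [ne_eq, h, not_false_eq_true, if_true]
          rw [← Finset.sum_mul, sum_ite_enc_eq h, ← hN]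
          ring
      rw [Finset.sum_add_distrib, ← Finset.mul_sum, ← Finset.mul_sum, Finset.sum_add_distrib, e5, c, c]
      ring
    -- Raising the factor `2` to `4` and restoring the terms `y = x` only increases the bound, and
    -- leaves exactly the two test errors.
    have e2 : ∑ x, (2 * a x + 4 * (η * (A x).trace.re
          + ∑ y, if y ≠ x then (M : ℝ)⁻¹ * b x y else 0))
        ≤ 4 * ∑ x, (a x + (M : ℝ)⁻¹ * ∑ y, b y x) + 4 * η * ∑ x, (A x).trace.re := by
      have e3 : ∑ x, ∑ y, (M : ℝ)⁻¹ * b x y = ∑ x, (M : ℝ)⁻¹ * ∑ y, b y x := by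
        rw [Finset.sum_comm]
        simp_rw [Finset.mul_sum]
      rw [Finset.sum_add_distrib (f := a), ← e3, ← Finset.sum_add_distrib, Finset.mul_sum,
        Finset.mul_sum, ← Finset.sum_add_distrib]
      refine Finset.sum_le_sum fun x _ => ?_
      have ha0 : 0 ≤ a x := trace_mul_re_nonneg (hA0 x) (sub_nonneg.mpr (hT1 x))
      have : ∑ y, (if y ≠ x then (M : ℝ)⁻¹ * b x y else 0) ≤ ∑ y, (M : ℝ)⁻¹ * b x y := by
        refine Finset.sum_le_sum fun y _ => ?_
        split_ifs
        · exact le_rfl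
        · exact mul_nonneg (inv_nonneg.mpr hM'.le) (hb0 x y)
      nlinarith
    have e4 : ∑ x, (a x + (M : ℝ)⁻¹ * ∑ y, b y x) ≤ (M : ℝ) ^ (-s) * F.petz s := by
      unfold SpectralFamily.petz
      rw [Finset.mul_sum]
      refine Finset.sum_le_sum fun x _ => ?_
      have h1 := hT x
      rw [← F.eq_diagConj x, diagConj_smul, ← F.sum_eq_diagConj, Matrix.smul_mul, trace_smul,
        smul_eq_mul, Complex.re_ofReal_mul, Finset.sum_mul, trace_sum, Complex.re_sum] at h1
      refine h1.trans_eq ?_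
      rw [Finset.mul_sum]
      refine Finset.sum_congr rfl fun i _ => ?_
      rw [Finset.mul_sum]
      refine Finset.sum_congr rfl fun j _ => ?_
      rw [Real.mul_rpow (inv_nonneg.mpr hM'.le) (F.m_nonneg j), Real.inv_rpow hM'.le,
        Real.rpow_neg hM'.le]
      ring
    have hN0 : 0 ≤ N := Finset.sum_nonneg fun _ _ => zero_le_one
    have c : ∀ r : ℝ, ∑ _enc : X → Fin M, r = N * r := fun r => by
      rw [hN, Finset.sum_mul, one_mul]
    rw [e1, c]
    exact mul_le_mul_of_nonneg_left (by linarith) hN0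
  obtain ⟨enc, -, henc⟩ := Finset.exists_le_of_sum_le Finset.univ_nonempty havg
  refine ⟨enc, dec enc, fun w x => nonneg_iff_posSemidef.mp (hdec0 enc w x), hdec1 enc, ?_⟩
  rw [← Finset.sum_sub_distrib]
  exact (Finset.sum_le_sum fun x _ => hloss enc x).trans henc

end RandomBinning

/-! ### The one-shot converse. -/

section Converse

open scoped Matrix.Norms.L2Operator MatrixOrder

variable {X D : Type*} [Fintype X] [DecidableEq X] [Fintype D] [DecidableEq D]

theorem mul_self_le_self {T : Matrix D D ℂ} (h0 : 0 ≤ T) (h1 : T ≤ 1) : T * T ≤ T := by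
  obtain ⟨U, hU, l, hl, rfl⟩ := exists_eq_diagConj_of_posSemidef (nonneg_iff_posSemidef.mp h0)
  have hl1 : ∀ i, l i ≤ 1 := by
    have : (1 : Matrix D D ℂ) = diagConj U (fun _ => 1) := by simp [diagConj_const hU]
    rw [this] at h1
    exact le_of_diagConj_le hU h1
  rw [diagConj_mul hU]
  exact diagConj_mono U fun i => mul_le_of_le_one_left (hl i) (hl1 i)

/-- The **Nussbaum–Szkoła lower bound** on the errors of a quantum test. -/
theorem min_sum_le_test {U W : Matrix D D ℂ} (hU : U ∈ unitaryGroup D ℂ)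
    (hW : W ∈ unitaryGroup D ℂ) {l m : D → ℝ} (hl : ∀ i, 0 ≤ l i) (hm : ∀ i, 0 ≤ m i)
    {T : Matrix D D ℂ} (hT0 : 0 ≤ T) (hT1 : T ≤ 1) :
    ∑ i, ∑ j, min (l i) (m j) * overlap U W i j
      ≤ 2 * ((diagConj U l * (1 - T)).trace.re + (diagConj W m * T).trace.re) := by
  have hTH : Tᴴ = T := (nonneg_iff_posSemidef.mp hT0).1
  have hRH : (1 - T)ᴴ = 1 - T := (nonneg_iff_posSemidef.mp (sub_nonneg.mpr hT1)).1
  -- Completeness of the basis `V` gives `R V Vᴴ R = R²`; hence the summed overlaps with `R V` are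
  -- expectations of `R²`, which is at most `R` for `R = T` and `R = 1 - T`.
  have sq_eq : ∀ {V R : Matrix D D ℂ}, V ∈ unitaryGroup D ℂ → Rᴴ = R →
      diagConj (R * V) (fun _ => 1) = R * R := by
    intro V R hV hR
    have h : V * Vᴴ = 1 := mem_unitaryGroup_iff.mp hV
    unfold diagConj
    simp only [Complex.ofReal_one, diagonal_one, Matrix.mul_one, conjTranspose_mul, hR]
    rw [Matrix.mul_assoc, ← Matrix.mul_assoc V, h, Matrix.one_mul]
  have h1 : ∑ i, ∑ j, l i * overlap U ((1 - T) * W) i j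
      ≤ (diagConj U l * (1 - T)).trace.re := by
    refine le_trans (le_of_eq ?_) (trace_mul_re_le_left (diagConj_nonneg U hl)
      (mul_self_le_self (sub_nonneg.mpr hT1) (sub_le_self _ hT0)))
    rw [← sq_eq hW hRH, trace_diagConj_mul_diagConj, Complex.ofReal_re]
    simp
  have h2 : ∑ i, ∑ j, m j * overlap (T * U) W i j ≤ (diagConj W m * T).trace.re := by
    refine le_trans (le_of_eq ?_) (trace_mul_re_le_left (diagConj_nonneg W hm)
      (mul_self_le_self hT0 hT1))
    rw [← sq_eq hU hTH, trace_mul_comm, trace_diagConj_mul_diagConj, Complex.ofReal_re]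
    simp
  refine le_trans ?_ (mul_le_mul_of_nonneg_left (add_le_add h1 h2) zero_le_two)
  rw [← Finset.sum_add_distrib, Finset.mul_sum]
  refine Finset.sum_le_sum fun i _ => ?_
  rw [← Finset.sum_add_distrib, Finset.mul_sum]
  refine Finset.sum_le_sum fun j _ => ?_
  unfold overlap
  -- The amplitude splits as `⟨u|(1 - T)|w⟩ + ⟨u|T|w⟩`. Since `|u + v|² ≤ 2(|u|² + |v|²)`, the first
  -- part can be charged to `l` and the second to `m`.
  have e : (Uᴴ * W) i j = (Uᴴ * ((1 - T) * W)) i j + ((T * U)ᴴ * W) i j := by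
    rw [conjTranspose_mul, hTH, ← Matrix.add_apply, Matrix.mul_assoc, ← Matrix.mul_add,
      ← Matrix.add_mul]
    simp
  rw [e]
  set u := (Uᴴ * ((1 - T) * W)) i j
  set v := ((T * U)ᴴ * W) i j
  have hp : Complex.normSq (u + v) ≤ 2 * (Complex.normSq u + Complex.normSq v) := by
    simp only [Complex.normSq_apply, Complex.add_re, Complex.add_im]
    nlinarith [sq_nonneg (u.re - v.re), sq_nonneg (u.im - v.im)]
  have hmin : 0 ≤ min (l i) (m j) := le_min (hl i) (hm j)
  have hu := mul_le_mul_of_nonneg_right (min_le_left (l i) (m j)) (Complex.normSq_nonneg u)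
  have hv := mul_le_mul_of_nonneg_right (min_le_right (l i) (m j)) (Complex.normSq_nonneg v)
  nlinarith [mul_le_mul_of_nonneg_left hp hmin]

/-- One-shot converse for classical data compression with quantum side information. -/
theorem SpectralFamily.minSum_le {A : X → Matrix D D ℂ} (F : SpectralFamily A)
    {M : ℕ} (enc : X → Fin M) (dec : Fin M → X → Matrix D D ℂ)
    (hdec0 : ∀ w x, (dec w x).PosSemidef) (hdec1 : ∀ w, ∑ x, dec w x = 1) {c : ℝ} (hc : 0 ≤ c) :
    F.minSum c ≤ 2 * ((∑ x, (A x).trace.re - ∑ x, (dec (enc x) x * A x).trace.re)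
      + c * M * ∑ x, (A x).trace.re) := by
  have hd0 : ∀ w x, 0 ≤ dec w x := fun w x => nonneg_iff_posSemidef.mpr (hdec0 w x)
  have hd1 : ∀ w x, dec w x ≤ 1 := fun w x => by
    rw [← hdec1 w]
    exact Finset.single_le_sum (f := dec w) (fun y _ => hd0 w y) (Finset.mem_univ x)
  have hB0 : 0 ≤ ∑ x, A x := by rw [F.sum_eq_diagConj]; exact diagConj_nonneg _ F.m_nonneg
  have h1 : F.minSum c ≤ ∑ x, 2 * ((A x * (1 - dec (enc x) x)).trace.re
      + c * ((∑ x, A x) * dec (enc x) x).trace.re) := by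
    unfold SpectralFamily.minSum
    rw [Fintype.sum_prod_type]
    refine Finset.sum_le_sum fun x _ => ?_
    rw [Fintype.sum_prod_type]
    refine (min_sum_le_test (F.U_mem x) F.W_mem (F.l_nonneg x) (m := fun j => c * F.m j)
      (fun j => mul_nonneg hc (F.m_nonneg j)) (hd0 _ _) (hd1 (enc x) x)).trans_eq ?_
    rw [diagConj_smul, ← F.sum_eq_diagConj, ← F.eq_diagConj, Matrix.smul_mul, trace_smul,
      smul_eq_mul, Complex.re_ofReal_mul]
  -- Each letter uses one message only; adding all other messages makes every POVM complete and
  -- costs the factor `M`.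
  have h2 : ∑ x, ((∑ x, A x) * dec (enc x) x).trace.re ≤ M * ∑ x, (A x).trace.re := by
    calc ∑ x, ((∑ x, A x) * dec (enc x) x).trace.re
        ≤ ∑ x, ∑ w, ((∑ x, A x) * dec w x).trace.re :=
          Finset.sum_le_sum fun x _ => Finset.single_le_sum
            (f := fun w => ((∑ x, A x) * dec w x).trace.re)
            (fun w _ => trace_mul_re_nonneg hB0 (hd0 w x)) (Finset.mem_univ (enc x))
      _ = ∑ w : Fin M, ((∑ x, A x) * ∑ x, dec w x).trace.re := by
          rw [Finset.sum_comm]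
          refine Finset.sum_congr rfl fun w _ => ?_
          rw [Finset.mul_sum, trace_sum, Complex.re_sum]
      _ = M * ∑ x, (A x).trace.re := by
          simp_rw [hdec1, Matrix.mul_one, trace_sum, Complex.re_sum]
          simp
  refine h1.trans ?_
  rw [← Finset.mul_sum, Finset.sum_add_distrib, ← Finset.mul_sum, ← Finset.sum_sub_distrib]
  have h3 : ∀ x, (A x * (1 - dec (enc x) x)).trace.re
      = (A x).trace.re - (dec (enc x) x * A x).trace.re := fun x => by
    rw [Matrix.mul_sub, Matrix.mul_one, trace_sub, Complex.sub_re, trace_mul_comm]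
  simp_rw [h3]
  nlinarith [mul_le_mul_of_nonneg_left h2 hc]

end Converse

/-! ### Moderate deviations for sums of independent variables. -/

section ModerateDeviations

variable {Ω : Type*} [Fintype Ω]

/-- The moment generating function of `Y` under the weights `P`. -/
noncomputable def finMgf (P Y : Ω → ℝ) (t : ℝ) : ℝ := ∑ w, P w * Real.exp (t * Y w)

theorem finMgf_pow (P Y : Ω → ℝ) (t : ℝ) (n : ℕ) :
    finMgf P Y t ^ n
      = ∑ v : Fin n → Ω, (∏ k, P (v k)) * Real.exp (t * ∑ k, Y (v k)) := by
  unfold finMgf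
  rw [Fintype.sum_pow]
  refine Finset.sum_congr rfl fun v _ => ?_
  rw [Finset.prod_mul_distrib, Finset.mul_sum, Real.exp_sum]

theorem abs_finMgf_sub_le {P Y : Ω → ℝ} (hP : ∀ w, 0 ≤ P w) (hP1 : ∑ w, P w = 1)
    (hY : ∑ w, P w * Y w = 0) {K : ℝ} (hK : ∀ w, |Y w| ≤ K) {t : ℝ} (ht : 0 ≤ t)
    (htK : t * K ≤ 1) :
    |finMgf P Y t - (1 + t ^ 2 * (∑ w, P w * Y w ^ 2) / 2)| ≤ t ^ 3 * K ^ 3 := by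
  have e : finMgf P Y t - (1 + t ^ 2 * (∑ w, P w * Y w ^ 2) / 2)
      = ∑ w, P w * (Real.exp (t * Y w) - (1 + t * Y w + (t * Y w) ^ 2 / 2)) := by
    have h : ∑ w, P w * (Real.exp (t * Y w) - (1 + t * Y w + (t * Y w) ^ 2 / 2))
        = finMgf P Y t - (∑ w, P w + t * ∑ w, P w * Y w
          + t ^ 2 / 2 * ∑ w, P w * Y w ^ 2) := by
      unfold finMgf
      rw [Finset.mul_sum, Finset.mul_sum, ← Finset.sum_add_distrib, ← Finset.sum_add_distrib,
        ← Finset.sum_sub_distrib]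
      exact Finset.sum_congr rfl fun w _ => by ring
    rw [h, hP1, hY]
    ring
  rw [e]
  calc _ ≤ ∑ w, |P w * (Real.exp (t * Y w) - (1 + t * Y w + (t * Y w) ^ 2 / 2))| :=
        Finset.abs_sum_le_sum_abs _ _
    _ ≤ ∑ w, P w * (t ^ 3 * K ^ 3) := by
        refine Finset.sum_le_sum fun w _ => ?_
        rw [abs_mul, abs_of_nonneg (hP w)]
        refine mul_le_mul_of_nonneg_left ?_ (hP w)
        have h1 : |t * Y w| ≤ t * K := by
          rw [abs_mul, abs_of_nonneg ht]
          exact mul_le_mul_of_nonneg_left (hK w) ht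
        have h2 := Real.exp_bound (h1.trans htK) (n := 3) (by norm_num)
        simp only [Finset.sum_range_succ, Finset.sum_range_zero, Nat.factorial] at h2
        norm_num at h2
        have h3 : |t * Y w| ^ 3 ≤ (t * K) ^ 3 := pow_le_pow_left₀ (abs_nonneg _) h1 3
        rw [← abs_mul] at h2
        have h4 : 0 ≤ |t * Y w| ^ 3 := by positivity
        rw [← mul_pow]
        nlinarith
    _ = _ := by rw [← Finset.sum_mul, hP1, one_mul]

/-- Gaussian bounds for the moment generating function of a centred variable near `0`. -/
theorem exists_finMgf_bounds {P Y : Ω → ℝ} (hP : ∀ w, 0 ≤ P w) (hP1 : ∑ w, P w = 1)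
    (hY : ∑ w, P w * Y w = 0) {σ : ℝ} (hσ : 0 < σ) (hYσ : ∑ w, P w * Y w ^ 2 = σ ^ 2)
    {δ : ℝ} (hδ0 : 0 < δ) (hδ1 : δ < 1) :
    ∃ t₁ > 0, ∀ t, 0 ≤ t → t ≤ t₁ →
      Real.exp ((1 - δ) * (t ^ 2 * σ ^ 2 / 2)) ≤ finMgf P Y t ∧
      finMgf P Y t ≤ Real.exp ((1 + δ) * (t ^ 2 * σ ^ 2 / 2)) := by
  set K := 1 + ∑ w, |Y w| with hKdef
  have hK1 : 1 ≤ K := le_add_of_nonneg_right (Finset.sum_nonneg fun w _ => abs_nonneg _)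
  have hK : ∀ w, |Y w| ≤ K := fun w =>
    (Finset.single_le_sum (f := fun w => |Y w|) (fun w _ => abs_nonneg _)
      (Finset.mem_univ w)).trans (by linarith)
  have hK0 : 0 < K := by linarith
  have hden : 0 < σ ^ 4 / 4 + K ^ 3 := by positivity
  -- The first entry keeps `t * K ≤ 1` for the Taylor bound. The second makes the quartic and cubic
  -- remainders together at most `δ u`, where `u = t² σ² / 2`.
  refine ⟨min K⁻¹ (δ * σ ^ 2 / 2 / (σ ^ 4 / 4 + K ^ 3)), by positivity, fun t ht0 ht1 => ?_⟩
  have htK : t * K ≤ 1 := by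
    have := mul_le_mul_of_nonneg_right (ht1.trans (min_le_left _ _)) hK0.le
    rwa [inv_mul_cancel₀ hK0.ne'] at this
  have htδ : t * (σ ^ 4 / 4 + K ^ 3) ≤ δ * σ ^ 2 / 2 :=
    (le_div_iff₀ hden).mp (ht1.trans (min_le_right _ _))
  have ht_one : t ≤ 1 := by nlinarith
  have habs := abs_le.mp (abs_finMgf_sub_le hP hP1 hY hK ht0 htK)
  rw [hYσ] at habs
  set u := t ^ 2 * σ ^ 2 / 2 with hu
  have hu0 : 0 ≤ u := by positivity
  have hrem : u ^ 2 + t ^ 3 * K ^ 3 ≤ δ * u := by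
    have h1 : t ^ 4 ≤ t ^ 3 := pow_le_pow_of_le_one ht0 ht_one (by norm_num)
    have h2 := mul_le_mul_of_nonneg_left htδ (sq_nonneg t)
    have h3 := mul_le_mul_of_nonneg_right h1 (by positivity : 0 ≤ σ ^ 4 / 4)
    rw [hu]
    nlinarith
  have hcube : 0 ≤ t ^ 3 * K ^ 3 := by positivity
  constructor
  · have hu1 : u ≤ 1 := by
      rcases hu0.eq_or_lt with h | h
      · linarith
      · have : u * u ≤ δ * u := by nlinarith
        linarith [le_of_mul_le_mul_right this h]
    have hy0 : 0 ≤ (1 - δ) * u := mul_nonneg (by linarith) hu0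
    have hyu : (1 - δ) * u ≤ u := by nlinarith
    have h1 := Real.abs_exp_sub_one_sub_id_le (x := (1 - δ) * u)
      (abs_le.mpr ⟨by linarith, by linarith⟩)
    have h2 := (abs_le.mp h1).2
    have h3 : ((1 - δ) * u) ^ 2 ≤ u ^ 2 := pow_le_pow_left₀ hy0 hyu 2
    nlinarith
  · refine le_trans ?_ (Real.add_one_le_exp _)
    nlinarith [sq_nonneg u]

/-- The exponents of the two discarded tails are smaller than that of the window. -/
theorem tilting_exponents {κ δ : ℝ} (hκ0 : 0 < κ) (hκ1 : κ ≤ 1) (hδ : δ * 26 = κ ^ 2) :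
    (κ * 2 + (1 + δ) ≤ (1 - δ) * (1 + κ) ^ 2 - κ ^ 2 / 2) ∧
    (-(κ * (1 + 2 * κ) * 2) + (1 + δ) * (1 + 2 * κ) ^ 2
      ≤ (1 - δ) * (1 + κ) ^ 2 - κ ^ 2 / 2) ∧
    -(1 + 8 * κ) + (1 + κ) * (1 + 2 * κ) * 2 ≤ (1 - δ) * (1 + κ) ^ 2 := by
  have hδ0 : 0 ≤ δ := by nlinarith
  have hκ2 : κ ^ 2 ≤ κ := by nlinarith
  -- For `κ ≤ 1` the coefficients of `δ` are at most `9 + 4 = 13`, and `13 δ = κ² / 2` is half of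
  -- the gap `κ²` present at `δ = 0`.
  have h1 : δ * (1 + (1 + κ) ^ 2) ≤ δ * 13 := mul_le_mul_of_nonneg_left (by nlinarith) hδ0
  have h2 : δ * ((1 + 2 * κ) ^ 2 + (1 + κ) ^ 2) ≤ δ * 13 :=
    mul_le_mul_of_nonneg_left (by nlinarith) hδ0
  have h3 : δ * (1 + κ) ^ 2 ≤ δ * 4 := mul_le_mul_of_nonneg_left (by nlinarith) hδ0
  refine ⟨by linarith, by linarith, by linarith⟩

set_option maxHeartbeats 1000000 in
/-- Moderate-deviation lower bound for the upper tail of a sum of independent copies of a centred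
variable. -/
theorem exists_tail_lower_bound {P Y : Ω → ℝ} (hP : ∀ w, 0 ≤ P w) (hP1 : ∑ w, P w = 1)
    (hY : ∑ w, P w * Y w = 0) {σ : ℝ} (hσ : 0 < σ) (hYσ : ∑ w, P w * Y w ^ 2 = σ ^ 2)
    {κ : ℝ} (hκ0 : 0 < κ) (hκ1 : κ ≤ 1) :
    ∃ x₁ > 0, ∃ N₀ : ℝ, ∀ (n : ℕ) (x : ℝ), 0 < x → x ≤ x₁ → N₀ ≤ n * x ^ 2 →
      1 / 2 * Real.exp (-((1 + 8 * κ) * (n * x ^ 2 / (2 * σ ^ 2))))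
        ≤ ∑ v : Fin n → Ω with n * x ≤ ∑ k, Y (v k), ∏ k, P (v k) := by
  classical
  have hσ2 : 0 < σ ^ 2 := by positivity
  obtain ⟨δ, hδ⟩ : ∃ δ, δ * 26 = κ ^ 2 := ⟨κ ^ 2 / 26, by ring⟩
  have hδ0 : 0 < δ := by nlinarith
  have hδ1 : δ < 1 := by nlinarith
  obtain ⟨hexp1, hexp2, hexp3⟩ := tilting_exponents hκ0 hκ1 hδ
  obtain ⟨t₁, ht₁, hmgf⟩ := exists_finMgf_bounds hP hP1 hY hσ hYσ hδ0 hδ1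
  -- `x₁` keeps the largest tilt used, `(1 + 2κ) x / σ²`, below `t₁`. The threshold `N₀` makes `exp
  -- (-(κ² / 2) q) ≤ 1 / 4`.
  refine ⟨t₁ * σ ^ 2 / (1 + 2 * κ), by positivity, Real.log 4 * (4 * σ ^ 2 / κ ^ 2),
    fun n x hx0 hx1 hN => ?_⟩
  have hx : x / σ ^ 2 * (1 + 2 * κ) ≤ t₁ := by
    rw [le_div_iff₀ (by positivity)] at hx1
    rw [div_mul_eq_mul_div, div_le_iff₀ hσ2]
    exact hx1
  set r := x / σ ^ 2 with hr
  have hr0 : 0 < r := by positivity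
  have hxr : x = r * σ ^ 2 := by rw [hr]; field_simp
  set q := (n : ℝ) * x ^ 2 / (2 * σ ^ 2) with hq
  have hq' : n * (r ^ 2 * σ ^ 2 / 2) = q := by rw [hq, hxr]; field_simp
  have hq0 : 0 ≤ q := by positivity
  set Pn : (Fin n → Ω) → ℝ := fun v => ∏ k, P (v k) with hPn
  set S : (Fin n → Ω) → ℝ := fun v => ∑ k, Y (v k) with hS
  have hPn0 : ∀ v, 0 ≤ Pn v := fun v => Finset.prod_nonneg fun k _ => hP _
  have mgf_nonneg : ∀ t, 0 ≤ finMgf P Y t := fun t =>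
    Finset.sum_nonneg fun w _ => mul_nonneg (hP w) (Real.exp_pos _).le
  have upper : ∀ c, 0 ≤ c → c ≤ 1 + 2 * κ →
      ∑ v, Pn v * Real.exp (c * r * S v) ≤ Real.exp ((1 + δ) * c ^ 2 * q) := by
    intro c hc0 hc1
    rw [hPn, hS, ← finMgf_pow]
    refine (pow_le_pow_left₀ (mgf_nonneg _) (hmgf (c * r) (by positivity)
      (by linarith [mul_le_mul_of_nonneg_right hc1 hr0.le])).2
      n).trans_eq ?_
    rw [← Real.exp_nat_mul, ← hq']
    congr 1
    ring
  have lower : Real.exp ((1 - δ) * (1 + κ) ^ 2 * q)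
      ≤ ∑ v, Pn v * Real.exp ((1 + κ) * r * S v) := by
    rw [hPn, hS, ← finMgf_pow]
    refine le_trans (le_of_eq ?_) (pow_le_pow_left₀ (Real.exp_pos _).le
      (hmgf ((1 + κ) * r) (by positivity) (by linarith [mul_pos hκ0 hr0])).1 n)
    rw [← Real.exp_nat_mul, ← hq']
    congr 1
    ring
  have hnx : n * x * r = 2 * q := by rw [← hq', hxr]; ring
  set Main := Real.exp ((1 - δ) * (1 + κ) ^ 2 * q) with hMain
  have hgap : Real.exp (-(κ ^ 2 / 2 * q)) ≤ 1 / 4 := by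
    have h1 : Real.log 4 ≤ κ ^ 2 / 2 * q := by
      have h2 : κ ^ 2 / 2 * q = n * x ^ 2 / (4 * σ ^ 2 / κ ^ 2) := by
        rw [hq]; field_simp; ring
      rw [h2, le_div_iff₀ (by positivity)]
      exact hN
    rw [Real.exp_neg, one_div]
    refine inv_anti₀ (by norm_num) ?_
    rwa [← Real.log_le_iff_le_exp (by norm_num)]
  -- Tilting by `(1 + κ) r` centres the sum near `(1 + κ) n x`, inside the window from `n x` to `(1
  -- + 2κ) n x`. Chernoff bounds with tilts `r` and `(1 + 2κ) r` show that each side of the window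
  -- carries at most a quarter of the tilted mass.
  have hlow : ∑ v with S v < n * x, Pn v * Real.exp ((1 + κ) * r * S v) ≤ Main * (1 / 4) := by
    calc _ ≤ ∑ v with S v < n * x,
          Real.exp (κ * (2 * q)) * (Pn v * Real.exp (1 * r * S v)) := by
          refine Finset.sum_le_sum fun v hv => ?_
          rw [Finset.mem_filter] at hv
          rw [mul_left_comm, ← Real.exp_add]
          refine mul_le_mul_of_nonneg_left (Real.exp_le_exp.mpr ?_) (hPn0 v)
          rw [← hnx]
          linarith [mul_le_mul_of_nonneg_left hv.2.le (mul_nonneg hκ0.le hr0.le)]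
      _ ≤ ∑ v, Real.exp (κ * (2 * q)) * (Pn v * Real.exp (1 * r * S v)) :=
          Finset.sum_le_sum_of_subset_of_nonneg (Finset.filter_subset _ _) fun v _ _ =>
            mul_nonneg (Real.exp_pos _).le (mul_nonneg (hPn0 v) (Real.exp_pos _).le)
      _ ≤ Real.exp (κ * (2 * q)) * Real.exp ((1 + δ) * 1 ^ 2 * q) := by
          rw [← Finset.mul_sum]
          exact mul_le_mul_of_nonneg_left (upper 1 zero_le_one (by linarith)) (Real.exp_pos _).le
      _ ≤ Main * Real.exp (-(κ ^ 2 / 2 * q)) := by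
          rw [← Real.exp_add, hMain, ← Real.exp_add]
          refine Real.exp_le_exp.mpr ?_
          linarith [mul_le_mul_of_nonneg_right hexp1 hq0]
      _ ≤ _ := mul_le_mul_of_nonneg_left hgap (Real.exp_pos _).le
  have hupp : ∑ v with n * ((1 + 2 * κ) * x) < S v, Pn v * Real.exp ((1 + κ) * r * S v)
      ≤ Main * (1 / 4) := by
    calc _ ≤ ∑ v with n * ((1 + 2 * κ) * x) < S v,
          Real.exp (-(κ * (1 + 2 * κ) * (2 * q))) * (Pn v * Real.exp ((1 + 2 * κ) * r * S v)) := by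
          refine Finset.sum_le_sum fun v hv => ?_
          rw [Finset.mem_filter] at hv
          rw [mul_left_comm, ← Real.exp_add]
          refine mul_le_mul_of_nonneg_left (Real.exp_le_exp.mpr ?_) (hPn0 v)
          rw [← hnx]
          linarith [mul_le_mul_of_nonneg_left hv.2.le (mul_nonneg hκ0.le hr0.le)]
      _ ≤ ∑ v, Real.exp (-(κ * (1 + 2 * κ) * (2 * q)))
            * (Pn v * Real.exp ((1 + 2 * κ) * r * S v)) :=
          Finset.sum_le_sum_of_subset_of_nonneg (Finset.filter_subset _ _) fun v _ _ =>
            mul_nonneg (Real.exp_pos _).le (mul_nonneg (hPn0 v) (Real.exp_pos _).le)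
      _ ≤ Real.exp (-(κ * (1 + 2 * κ) * (2 * q)))
            * Real.exp ((1 + δ) * (1 + 2 * κ) ^ 2 * q) := by
          rw [← Finset.mul_sum]
          exact mul_le_mul_of_nonneg_left (upper (1 + 2 * κ) (by positivity) le_rfl)
            (Real.exp_pos _).le
      _ ≤ Main * Real.exp (-(κ ^ 2 / 2 * q)) := by
          rw [← Real.exp_add, hMain, ← Real.exp_add]
          refine Real.exp_le_exp.mpr ?_
          linarith [mul_le_mul_of_nonneg_right hexp2 hq0]
      _ ≤ _ := mul_le_mul_of_nonneg_left hgap (Real.exp_pos _).le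
  -- On the window the tilting factor is bounded by its value at the upper end, so the tilt can be
  -- undone.
  have hwin : ∑ v with n * x ≤ S v ∧ S v ≤ n * ((1 + 2 * κ) * x),
      Pn v * Real.exp ((1 + κ) * r * S v)
      ≤ Real.exp ((1 + κ) * (1 + 2 * κ) * (2 * q)) * ∑ v with n * x ≤ S v, Pn v := by
    rw [Finset.mul_sum]
    calc _ ≤ ∑ v with n * x ≤ S v ∧ S v ≤ n * ((1 + 2 * κ) * x),
          Real.exp ((1 + κ) * (1 + 2 * κ) * (2 * q)) * Pn v := by
          refine Finset.sum_le_sum fun v hv => ?_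
          rw [Finset.mem_filter] at hv
          rw [mul_comm]
          refine mul_le_mul_of_nonneg_right (Real.exp_le_exp.mpr ?_) (hPn0 v)
          rw [← hnx]
          have : 0 ≤ (1 + κ) * r := by positivity
          linarith [mul_le_mul_of_nonneg_left hv.2.2 this]
      _ ≤ _ := by
          refine Finset.sum_le_sum_of_subset_of_nonneg (fun v hv => ?_) fun v _ _ =>
            mul_nonneg (Real.exp_pos _).le (hPn0 v)
          rw [Finset.mem_filter] at hv ⊢
          exact ⟨hv.1, hv.2.1⟩
  have hsplit : ∑ v, Pn v * Real.exp ((1 + κ) * r * S v)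
      ≤ ∑ v with S v < n * x, Pn v * Real.exp ((1 + κ) * r * S v)
        + ∑ v with n * ((1 + 2 * κ) * x) < S v, Pn v * Real.exp ((1 + κ) * r * S v)
        + ∑ v with n * x ≤ S v ∧ S v ≤ n * ((1 + 2 * κ) * x),
            Pn v * Real.exp ((1 + κ) * r * S v) := by
    simp only [Finset.sum_filter]
    rw [← Finset.sum_add_distrib, ← Finset.sum_add_distrib]
    refine Finset.sum_le_sum fun v _ => ?_
    have h0 : 0 ≤ Pn v * Real.exp ((1 + κ) * r * S v) := mul_nonneg (hPn0 v) (Real.exp_pos _).le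
    by_cases h1 : S v < n * x
    · rw [if_pos h1]; split_ifs <;> linarith
    · by_cases h2 : n * ((1 + 2 * κ) * x) < S v
      · rw [if_pos h2]; split_ifs <;> linarith
      · rw [if_pos (⟨not_lt.mp h1, not_lt.mp h2⟩ : _ ∧ _)]; split_ifs; linarith
  have hfin : Main * (1 / 2)
      ≤ Real.exp ((1 + κ) * (1 + 2 * κ) * (2 * q)) * ∑ v with n * x ≤ S v, Pn v := by
    linarith
  have hexp : Real.exp (-((1 + 8 * κ) * q)) * Real.exp ((1 + κ) * (1 + 2 * κ) * (2 * q))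
      ≤ Main := by
    rw [← Real.exp_add, hMain]
    refine Real.exp_le_exp.mpr ?_
    linarith [mul_le_mul_of_nonneg_right hexp3 hq0]
  have hE := Real.exp_pos ((1 + κ) * (1 + 2 * κ) * (2 * q))
  refine le_of_mul_le_mul_left ?_ hE
  calc _ = Real.exp (-((1 + 8 * κ) * q)) * Real.exp ((1 + κ) * (1 + 2 * κ) * (2 * q))
        * (1 / 2) := by ring
    _ ≤ Main * (1 / 2) := mul_le_mul_of_nonneg_right hexp (by norm_num)
    _ ≤ _ := hfin

end ModerateDeviations

/-! ### From one-shot bounds to codes of block length `n`. -/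

section Codes

variable {X d : Type*} [Fintype X] [DecidableEq X] [Fintype d] [DecidableEq d]

theorem CQState.weighted_posSemidef (S : CQState X d) (x : X) : (S.weighted x).PosSemidef :=
  (S.state_posSemidef x).smul (by simpa using S.p_nonneg x)

theorem CQState.trace_weighted (S : CQState X d) (x : X) : (S.weighted x).trace = S.p x := by
  rw [CQState.weighted, trace_smul, S.state_trace, smul_eq_mul, mul_one]

theorem CQState.nonempty (S : CQState X d) : Nonempty X := by
  by_contra h
  rw [not_nonempty_iff] at h
  simpa using S.p_sum

theorem CQState.tensorFamily_weighted (S : CQState X d) {n : ℕ} (x : Fin n → X) :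
    (tensorFamily fun k => S.weighted (x k))
      = ((∏ k, S.p (x k) : ℝ) : ℂ) • tensorFamily fun k => S.state (x k) := by
  rw [Complex.ofReal_prod, ← tensorFamily_smul]
  rfl

theorem CQState.sum_trace_tensorFamily (S : CQState X d) (n : ℕ) :
    ∑ x : Fin n → X, (tensorFamily fun k => S.weighted (x k)).trace.re = 1 := by
  rw [← Complex.re_sum, ← trace_sum, sum_tensorFamily, trace_tensorFamily]
  simp only [trace_sum, S.trace_weighted]
  rw [← Complex.ofReal_sum, S.p_sum]
  simp

theorem SWCode.errorProb_eq (S : CQState X d) {n : ℕ} {R : ℝ} (C : SWCode X d n R) :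
    C.errorProb S = ∑ x : Fin n → X, (tensorFamily fun k => S.weighted (x k)).trace.re
      - ∑ x, (C.dec (C.enc x) x * tensorFamily fun k => S.weighted (x k)).trace.re := by
  rw [S.sum_trace_tensorFamily, SWCode.errorProb]
  congr 1
  refine Finset.sum_congr rfl fun x _ => ?_
  rw [S.tensorFamily_weighted, Matrix.mul_smul, trace_smul, smul_eq_mul, Complex.re_ofReal_mul]

variable {S : CQState X d} (F : SpectralFamily S.weighted)

/-- The parameter `s` plays the role of the Chernoff exponent. Rounding up the message set is
harmless because `M ^ (-s)` decreases in `M`. -/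
theorem SpectralFamily.exists_swCode {n : ℕ} {R : ℝ}
    (hsize : ⌈(2 : ℝ) ^ ((n : ℝ) * R)⌉₊ < Fintype.card X ^ n) {s : ℝ} (hs0 : 0 < s) (hs1 : s < 1)
    {η : ℝ} (hη : 0 < η) :
    ∃ C : SWCode X d n R, C.errorProb S
      ≤ 4 * ((2 : ℝ) ^ (-((n : ℝ) * R * s)) * F.petz s ^ n) + 4 * η := by
  have := S.nonempty
  have hpos : (0 : ℝ) < (2 : ℝ) ^ ((n : ℝ) * R) := Real.rpow_pos_of_pos two_pos _
  obtain ⟨enc, dec, h0, h1, h2⟩ := (F.tensorPower n).exists_code (Nat.ceil_pos.mpr hpos)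
    hs0 hs1 hη
  refine ⟨⟨enc, dec, hsize, h0, h1⟩, ?_⟩
  rw [SWCode.errorProb_eq]
  refine h2.trans ?_
  rw [S.sum_trace_tensorFamily, mul_one, F.petz_tensorPower]
  have hpetz : 0 ≤ F.petz s := by
    rw [F.petz_eq hs1]
    exact Finset.sum_nonneg fun w _ =>
      mul_nonneg (F.weight_nonneg w) (Real.rpow_pos_of_pos two_pos _).le
  have hM : ((⌈(2 : ℝ) ^ ((n : ℝ) * R)⌉₊ : ℕ) : ℝ) ^ (-s) ≤ (2 : ℝ) ^ (-((n : ℝ) * R * s)) := by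
    rw [← mul_neg, Real.rpow_mul zero_le_two (_ * R) (-s)]
    exact Real.rpow_le_rpow_of_nonpos hpos (Nat.le_ceil _)
      (neg_nonpos.mpr hs0.le)
  have := mul_le_mul_of_nonneg_right hM (pow_nonneg hpetz n)
  linarith

theorem SpectralFamily.minSum_le_errorProb {n : ℕ} {R : ℝ} (C : SWCode X d n R) {c : ℝ}
    (hc : 0 ≤ c) :
    (F.tensorPower n).minSum c
      ≤ 2 * (C.errorProb S + c * (⌈(2 : ℝ) ^ ((n : ℝ) * R)⌉₊ : ℕ)) := by
  have h := (F.tensorPower n).minSum_le C.enc C.dec C.dec_posSemidef C.dec_sum hc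
  rw [← SWCode.errorProb_eq, S.sum_trace_tensorFamily, mul_one] at h
  exact h

end Codes

/-! ### The bounds `0 ≤ H(X|B) < log |X|`. -/

section EntropyBounds

open scoped Matrix.Norms.L2Operator MatrixOrder

variable {X d : Type*} [Fintype X] [DecidableEq X] [Fintype d] [DecidableEq d]

namespace SpectralFamily

variable {A : X → Matrix d d ℂ} (F : SpectralFamily A)

/-- The mean of the log-ratio. -/
noncomputable def mean : ℝ := ∑ w, F.weight w * F.logRatio w

/-- The variance of the log-ratio. -/
noncomputable def var : ℝ := ∑ w, F.weight w * F.logRatio w ^ 2 - F.mean ^ 2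

/-- The centred log-ratio, in nats. -/
noncomputable def centred (w : X × d × d) : ℝ := Real.log 2 * (F.logRatio w - F.mean)

theorem sum_weight_centred (h1 : ∑ w, F.weight w = 1) :
    ∑ w, F.weight w * F.centred w = 0 := by
  have : ∑ w, F.weight w * F.centred w
      = Real.log 2 * (∑ w, F.weight w * F.logRatio w - F.mean * ∑ w, F.weight w) := by
    rw [Finset.mul_sum, ← Finset.sum_sub_distrib, Finset.mul_sum]
    refine Finset.sum_congr rfl fun w _ => ?_
    unfold centred; ring
  rw [this, h1, mean]
  ring

theorem sum_weight_centred_sq (h1 : ∑ w, F.weight w = 1) :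
    ∑ w, F.weight w * F.centred w ^ 2 = Real.log 2 ^ 2 * F.var := by
  have : ∑ w, F.weight w * F.centred w ^ 2
      = Real.log 2 ^ 2 * (∑ w, F.weight w * F.logRatio w ^ 2
        - 2 * F.mean * ∑ w, F.weight w * F.logRatio w + F.mean ^ 2 * ∑ w, F.weight w) := by
    rw [Finset.mul_sum, Finset.mul_sum, ← Finset.sum_sub_distrib, ← Finset.sum_add_distrib,
      Finset.mul_sum]
    refine Finset.sum_congr rfl fun w _ => ?_
    unfold centred; ring
  rw [this, h1, var, ← mean]
  ring

theorem two_rpow_logRatio (s : ℝ) (w : X × d × d) :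
    (2 : ℝ) ^ (s * F.logRatio w) = (2 : ℝ) ^ (s * F.mean) * Real.exp (s * F.centred w) := by
  rw [Real.rpow_def_of_pos two_pos, Real.rpow_def_of_pos two_pos, ← Real.exp_add]
  congr 1
  unfold centred
  ring

theorem petz_eq_mul_finMgf {s : ℝ} (hs : s < 1) :
    F.petz s = (2 : ℝ) ^ (s * F.mean) * finMgf F.weight F.centred s := by
  rw [F.petz_eq hs, finMgf, Finset.mul_sum]
  refine Finset.sum_congr rfl fun w _ => ?_
  rw [F.two_rpow_logRatio]
  ring

/-- Each member is dominated by the sum, so the Petz quantity is at least the total weight. -/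
theorem sum_weight_le_petz {s : ℝ} (hs0 : 0 < s) (hs1 : s < 1) : ∑ w, F.weight w ≤ F.petz s := by
  rw [F.sum_weight, trace_sum, Complex.re_sum]
  refine Finset.sum_le_sum fun x _ => ?_
  have hA : ∀ y, 0 ≤ A y := fun y => by
    rw [F.eq_diagConj y]; exact diagConj_nonneg _ (F.l_nonneg y)
  have hle : diagConj (F.U x) (F.l x) ≤ diagConj F.W F.m := by
    rw [← F.eq_diagConj, ← F.sum_eq_diagConj]
    exact Finset.single_le_sum (fun y _ => hA y) (Finset.mem_univ x)
  have h := trace_mul_re_le_left (diagConj_nonneg (F.U x)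
    fun i => Real.rpow_nonneg (F.l_nonneg x i) (1 - s))
    (diagConj_rpow_mono (F.U_mem x) F.W_mem (F.l_nonneg x) F.m_nonneg hle hs0.le hs1.le)
  rw [F.trace_mul_diagConj, diagConj_mul (F.U_mem x)] at h
  refine le_trans (le_of_eq ?_) h
  rw [F.eq_diagConj x]
  congr 4
  funext i
  rw [← Real.rpow_add_of_nonneg (F.l_nonneg x i) (by linarith) hs0.le]
  simp

/-- The Petz quantity is at least `1` for every `s` in `(0, 1)`, while for small `s` its logarithm
is `s * mean * log 2 + O(s²)`; a negative mean would contradict this. -/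
theorem mean_nonneg (h1 : ∑ w, F.weight w = 1) (hv : 0 < F.var) : 0 ≤ F.mean := by
  have hlog : 0 < Real.log 2 := Real.log_pos one_lt_two
  have hσ : 0 < Real.log 2 * Real.sqrt F.var := mul_pos hlog (Real.sqrt_pos.mpr hv)
  have hσ2 : ∑ w, F.weight w * F.centred w ^ 2 = (Real.log 2 * Real.sqrt F.var) ^ 2 := by
    rw [F.sum_weight_centred_sq h1, mul_pow, Real.sq_sqrt hv.le]
  obtain ⟨t₁, ht₁, hmgf⟩ := exists_finMgf_bounds F.weight_nonneg h1 (F.sum_weight_centred h1) hσ hσ2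
    (δ := 1 / 2) (by norm_num) (by norm_num)
  set σ := Real.log 2 * Real.sqrt F.var
  by_contra! hneg
  have hc : 0 < -(F.mean * Real.log 2) := by nlinarith
  -- With this `t` the quadratic term cancels at most three quarters of the negative linear term.
  set t := min (min t₁ (1 / 2)) (-(F.mean * Real.log 2) / σ ^ 2) with ht
  have ht0 : 0 < t := by positivity
  have ht2 : t * σ ^ 2 ≤ -(F.mean * Real.log 2) := by
    rw [← le_div_iff₀ (by positivity)]
    exact min_le_right _ _
  have htt : t ≤ min t₁ (1 / 2) := min_le_left _ _
  have hts : t < 1 := by linarith [htt.trans (min_le_right _ _)]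
  have h2 := F.sum_weight_le_petz ht0 hts
  rw [h1, F.petz_eq_mul_finMgf hts] at h2
  have h3 := (hmgf t ht0.le (htt.trans (min_le_left _ _))).2
  have h4 : (1 : ℝ) ≤ Real.exp (Real.log 2 * (t * F.mean) + (1 + 1 / 2) * (t ^ 2 * σ ^ 2 / 2)) := by
    rw [Real.exp_add, ← Real.rpow_def_of_pos two_pos]
    exact h2.trans (mul_le_mul_of_nonneg_left h3 (Real.rpow_pos_of_pos two_pos _).le)
  rw [Real.one_le_exp_iff] at h4
  nlinarith [mul_le_mul_of_nonneg_left ht2 ht0.le, mul_pos ht0 hc]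

/-- Jensen's inequality for `E 2^Z ≤ |X|`; positive variance makes it strict. -/
theorem mean_lt_logb_card (h1 : ∑ w, F.weight w = 1) (hv : 0 < F.var) :
    F.mean < Real.logb 2 (Fintype.card X) := by
  have hub : ∑ w, F.weight w * (2 : ℝ) ^ F.logRatio w ≤ Fintype.card X := by
    have hm : ∑ j, F.m j = 1 := by
      have := F.sum_weight
      rw [h1, F.sum_eq_diagConj, trace_diagConj F.W_mem, Complex.ofReal_re] at this
      exact this.symm
    calc ∑ w, F.weight w * (2 : ℝ) ^ F.logRatio w
        ≤ ∑ w : X × d × d, F.m w.2.2 * overlap (F.U w.1) F.W w.2.1 w.2.2 := by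
          refine Finset.sum_le_sum fun w _ => ?_
          rcases (F.weight_nonneg w).eq_or_lt with h | h
          · rw [← h, zero_mul]
            exact mul_nonneg (F.m_nonneg _) (overlap_nonneg _ _ _ _)
          · have hl := F.l_pos_of_weight_pos h
            have hm := F.m_pos_of_weight_pos h
            refine le_of_eq ?_
            rw [logRatio, Real.rpow_sub two_pos, Real.rpow_logb two_pos (by norm_num) hm,
              Real.rpow_logb two_pos (by norm_num) hl, weight]
            field_simp
      _ = ∑ x : X, ∑ j, F.m j * ∑ i, overlap (F.U x) F.W i j := by
          rw [Fintype.sum_prod_type]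
          refine Finset.sum_congr rfl fun x _ => ?_
          rw [Fintype.sum_prod_type, Finset.sum_comm]
          refine Finset.sum_congr rfl fun j _ => ?_
          rw [Finset.mul_sum]
      _ = Fintype.card X := by
          simp_rw [fun x j => sum_overlap_left (F.U_mem x) F.W_mem j, mul_one, hm]
          simp
  have hgt : 1 < finMgf F.weight F.centred 1 := by
    have hpos : 0 < ∑ w, F.weight w * F.centred w ^ 2 := by
      rw [F.sum_weight_centred_sq h1]
      have : 0 < Real.log 2 := Real.log_pos one_lt_two
      positivity
    obtain ⟨w₀, -, hw₀⟩ := Finset.exists_lt_of_sum_lt (s := Finset.univ)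
      (f := fun _ : X × d × d => (0 : ℝ)) (by simpa using hpos)
    have hP : 0 < F.weight w₀ := by
      refine lt_of_le_of_ne (F.weight_nonneg w₀) fun h => ?_
      simp [← h] at hw₀
    have hY : F.centred w₀ ≠ 0 := fun h => by simp [h] at hw₀
    have e : (1 : ℝ) = ∑ w, F.weight w * (F.centred w + 1) := by
      simp_rw [mul_add, mul_one]
      rw [Finset.sum_add_distrib, F.sum_weight_centred h1, h1, zero_add]
    refine e.trans_lt ?_
    unfold finMgf
    refine Finset.sum_lt_sum (fun w _ => ?_) ⟨w₀, Finset.mem_univ _, ?_⟩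
    · rw [one_mul]
      exact mul_le_mul_of_nonneg_left (Real.add_one_le_exp _) (F.weight_nonneg w)
    · rw [one_mul]
      exact mul_lt_mul_of_pos_left (Real.add_one_lt_exp hY) hP
  have heq : ∑ w, F.weight w * (2 : ℝ) ^ F.logRatio w
      = (2 : ℝ) ^ F.mean * finMgf F.weight F.centred 1 := by
    rw [finMgf, Finset.mul_sum]
    refine Finset.sum_congr rfl fun w _ => ?_
    have := F.two_rpow_logRatio 1 w
    rw [one_mul, one_mul] at this
    rw [this]
    ring
  have h2 : (0 : ℝ) < (2 : ℝ) ^ F.mean := Real.rpow_pos_of_pos two_pos _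
  have h3 : (2 : ℝ) ^ F.mean < Fintype.card X := by
    rw [heq] at hub
    nlinarith
  exact (Real.lt_logb_iff_rpow_lt one_lt_two (h2.trans h3)).mpr h3

end SpectralFamily

end EntropyBounds

/-! ### Asymptotic achievability and converse. -/

section Asymptotics

variable {X d : Type*} [Fintype X] [DecidableEq X] [Fintype d] [DecidableEq d]
variable {S : CQState X d} (F : SpectralFamily S.weighted)
variable {a : ℕ → ℝ}

theorem CQState.sum_weight (F : SpectralFamily S.weighted) : ∑ w, F.weight w = 1 := by
  rw [F.sum_weight, trace_sum, Complex.re_sum]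
  simp_rw [S.trace_weighted, Complex.ofReal_re]
  exact S.p_sum

theorem eventually_pos_of_mul_sqrt (ha' : Tendsto (fun n : ℕ => a n * Real.sqrt n) atTop atTop) :
    ∀ᶠ n in atTop, 0 < a n := by
  filter_upwards [ha'.eventually_gt_atTop 0] with n hn
  exact pos_of_mul_pos_left hn (Real.sqrt_nonneg _)

theorem tendsto_nat_mul_sq (ha' : Tendsto (fun n : ℕ => a n * Real.sqrt n) atTop atTop) :
    Tendsto (fun n : ℕ => (n : ℝ) * a n ^ 2) atTop atTop := by
  have h := (tendsto_pow_atTop (two_ne_zero)).comp ha'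
  refine h.congr fun n => ?_
  simp only [Function.comp]
  rw [mul_pow, Real.sq_sqrt (Nat.cast_nonneg n), mul_comm]

theorem tendsto_nat_mul (ha' : Tendsto (fun n : ℕ => a n * Real.sqrt n) atTop atTop) :
    Tendsto (fun n : ℕ => (n : ℝ) * a n) atTop atTop := by
  have hs : Tendsto (fun n : ℕ => Real.sqrt n) atTop atTop :=
    Real.tendsto_sqrt_atTop.comp tendsto_natCast_atTop_atTop
  refine (ha'.atTop_mul_atTop₀ hs).congr fun n => ?_
  rw [mul_assoc, Real.mul_self_sqrt (Nat.cast_nonneg n), mul_comm]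

/-- Rates below the logarithm of the alphabet size are eventually admissible. -/
theorem eventually_ceil_lt {K : ℕ} (hK : 0 < K) {r : ℝ} (hr0 : 0 ≤ r) (hr : r < Real.logb 2 K) :
    ∀ᶠ n : ℕ in atTop, ∀ R ≤ r, ⌈(2 : ℝ) ^ ((n : ℝ) * R)⌉₊ < K ^ n := by
  have hK' : (0 : ℝ) < K := Nat.cast_pos.mpr hK
  -- One spare bit absorbs the rounding: `⌈2^(nR)⌉ < 2^(nr) + 1 ≤ 2 * 2^(nr) < K^n`.
  have ht : Tendsto (fun n : ℕ => (n : ℝ) * (Real.logb 2 K - r)) atTop atTop :=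
    tendsto_natCast_atTop_atTop.atTop_mul_const (sub_pos.mpr hr)
  filter_upwards [ht.eventually_gt_atTop 1] with n hn R hR
  have h1 : (1 : ℝ) ≤ (2 : ℝ) ^ ((n : ℝ) * r) := Real.one_le_rpow one_le_two (by positivity)
  have h2 : (2 : ℝ) < (2 : ℝ) ^ ((n : ℝ) * (Real.logb 2 K - r)) := by
    simpa using Real.rpow_lt_rpow_of_exponent_lt one_lt_two hn
  have h3 : ((K ^ n : ℕ) : ℝ)
      = (2 : ℝ) ^ ((n : ℝ) * r) * (2 : ℝ) ^ ((n : ℝ) * (Real.logb 2 K - r)) := by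
    rw [← Real.rpow_add two_pos, ← mul_add, add_sub_cancel, mul_comm, Real.rpow_mul zero_le_two,
      Real.rpow_logb two_pos (by norm_num) hK', Real.rpow_natCast]
    push_cast; rfl
  have h4 : (2 : ℝ) ^ ((n : ℝ) * R) ≤ (2 : ℝ) ^ ((n : ℝ) * r) :=
    Real.rpow_le_rpow_of_exponent_le one_le_two
      (mul_le_mul_of_nonneg_left hR (Nat.cast_nonneg n))
  have h5 := Nat.ceil_lt_add_one (Real.rpow_pos_of_pos two_pos ((n : ℝ) * R)).le
  rw [← Nat.cast_lt (α := ℝ), h3]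
  nlinarith

theorem converse_exponent {δ : ℝ} (hδ0 : 0 < δ) (hδ1 : δ < 1) :
    (1 + 8 * (δ / 16)) * (1 - δ / 2) ^ 2 ≤ 1 - δ / 2 := by
  have h1 : (1 + δ / 2) * (1 - δ / 2) ≤ 1 := by nlinarith
  have h2 : 0 ≤ 1 - δ / 2 := by linarith
  linarith [mul_le_mul_of_nonneg_right h1 h2]

namespace SpectralFamily

/-- Conversion of units: `σ` is the standard deviation in nats, while `√(2V)` is in bits. -/
theorem exists_sigma (hv : 0 < F.var) :
    ∃ σ > 0, σ ^ 2 = Real.log 2 ^ 2 * Real.sqrt (2 * F.var) ^ 2 / 2 ∧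
      ∑ w, F.weight w * F.centred w ^ 2 = σ ^ 2 := by
  have hlog : 0 < Real.log 2 := Real.log_pos one_lt_two
  refine ⟨Real.log 2 * Real.sqrt F.var, mul_pos hlog (Real.sqrt_pos.mpr hv), ?_, ?_⟩
  · rw [mul_pow, Real.sq_sqrt hv.le, Real.sq_sqrt (by positivity)]
    ring
  · rw [F.sum_weight_centred_sq (CQState.sum_weight F), mul_pow, Real.sq_sqrt hv.le]

/-- Achievability: rates above the moderate-deviation rate are eventually attained. -/
theorem eventually_exists_code (hv : 0 < F.var) (ha : Tendsto a atTop (𝓝 0))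
    (ha' : Tendsto (fun n : ℕ => a n * Real.sqrt n) atTop atTop) {δ : ℝ} (hδ : 0 < δ) :
    ∀ᶠ n : ℕ in atTop, 0 < F.mean + Real.sqrt (2 * F.var) * ((1 + δ) * a n) ∧
      ∃ C : SWCode X d n (F.mean + Real.sqrt (2 * F.var) * ((1 + δ) * a n)),
        C.errorProb S ≤ Real.exp (-((n : ℝ) * a n ^ 2)) := by
  have hP1 := CQState.sum_weight F
  have hlog : 0 < Real.log 2 := Real.log_pos one_lt_two
  have hmean := F.mean_nonneg hP1 hv
  have hlt := F.mean_lt_logb_card hP1 hv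
  obtain ⟨σ, hσ, hσβ, hYσ⟩ := F.exists_sigma hv
  set β := Real.sqrt (2 * F.var) with hβdef
  have hβ : 0 < β := Real.sqrt_pos.mpr (by positivity)
  have hδ1 : δ / (1 + δ) < 1 := by rw [div_lt_one (by positivity)]; linarith
  -- The slack `δ / (1 + δ)` is chosen so that `(1 + δ)² (2 - (1 + δ / (1 + δ))) = 1 + δ`, the
  -- exponent obtained in `hmain`.
  obtain ⟨t₁, ht₁, hmgf⟩ := exists_finMgf_bounds F.weight_nonneg hP1 (F.sum_weight_centred hP1) hσ
    hYσ (δ := δ / (1 + δ)) (by positivity) hδ1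
  have hcard : 0 < Fintype.card X := Fintype.card_pos_iff.mpr S.nonempty
  set r := (F.mean + Real.logb 2 (Fintype.card X)) / 2 with hr
  have hlim : ∀ c : ℝ, Tendsto (fun n => c * a n) atTop (𝓝 0) := fun c => by
    simpa using ha.const_mul c
  have hR : ∀ᶠ n in atTop, β * (1 + δ) * a n < r - F.mean :=
    (hlim _).eventually_lt_const (by rw [hr]; linarith)
  have hs : ∀ᶠ n in atTop, 2 * (1 + δ) / (Real.log 2 * β) * a n < min t₁ 1 :=
    (hlim _).eventually_lt_const (lt_min ht₁ one_pos)
  have hbig := ((tendsto_nat_mul_sq ha').const_mul_atTop hδ).eventually_ge_atTop (Real.log 8)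
  filter_upwards [eventually_pos_of_mul_sqrt ha', hR, hs, hbig,
    eventually_ceil_lt hcard (r := r) (by rw [hr]; linarith) (by rw [hr]; linarith)]
    with n han hRn hsn hbn hceil
  refine ⟨by positivity, ?_⟩
  -- The optimal Chernoff parameter for a Gaussian of variance `σ²`: excess rate in nats divided by
  -- `σ²`.
  set s := 2 * (1 + δ) / (Real.log 2 * β) * a n with hsdef
  have hs0 : 0 < s := by positivity
  have hs1 : s < 1 := hsn.trans_le (min_le_right _ _)
  have hst : s ≤ t₁ := hsn.le.trans (min_le_left _ _)
  obtain ⟨C, hC⟩ := F.exists_swCode (hceil (F.mean + β * ((1 + δ) * a n)) (by linarith)) hs0 hs1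
    (η := Real.exp (-((n : ℝ) * a n ^ 2)) / 8) (by positivity)
  refine ⟨C, hC.trans ?_⟩
  have hm := (hmgf s hs0.le hst).2
  have hm0 : 0 ≤ finMgf F.weight F.centred s :=
    Finset.sum_nonneg fun w _ => mul_nonneg (F.weight_nonneg w) (Real.exp_pos _).le
  have hmain : (2 : ℝ) ^ (-((n : ℝ) * (F.mean + β * ((1 + δ) * a n)) * s)) * F.petz s ^ n
      ≤ Real.exp (-((1 + δ) * (n * a n ^ 2))) := by
    rw [F.petz_eq_mul_finMgf hs1, mul_pow]
    calc _ ≤ (2 : ℝ) ^ (-((n : ℝ) * (F.mean + β * ((1 + δ) * a n)) * s))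
          * (((2 : ℝ) ^ (s * F.mean)) ^ n
            * Real.exp ((1 + δ / (1 + δ)) * (s ^ 2 * σ ^ 2 / 2)) ^ n) := by gcongr
      _ = _ := by
          rw [← Real.rpow_mul_natCast zero_le_two, ← mul_assoc, ← Real.rpow_add two_pos,
            Real.rpow_def_of_pos two_pos, ← Real.exp_nat_mul, ← Real.exp_add, hσβ, hsdef]
          congr 1
          field_simp
          ring
  have h8 : Real.exp (-((1 + δ) * (n * a n ^ 2))) ≤ Real.exp (-((n : ℝ) * a n ^ 2)) / 8 := by
    have : Real.exp (-((n : ℝ) * a n ^ 2)) / 8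
        = Real.exp (-((n : ℝ) * a n ^ 2) - Real.log 8) := by
      rw [Real.exp_sub, Real.exp_log (by norm_num)]
    rw [this]
    exact Real.exp_le_exp.mpr (by linarith)
  linarith

set_option maxHeartbeats 800000 in
/-- Converse: rates below the moderate-deviation rate eventually violate the error threshold. -/
theorem eventually_le_of_code (hv : 0 < F.var) (ha : Tendsto a atTop (𝓝 0))
    (ha' : Tendsto (fun n : ℕ => a n * Real.sqrt n) atTop atTop) {δ : ℝ} (hδ0 : 0 < δ)
    (hδ1 : δ < 1) :
    ∀ᶠ n : ℕ in atTop, ∀ R > 0, ∀ C : SWCode X d n R,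
      C.errorProb S ≤ Real.exp (-((n : ℝ) * a n ^ 2)) →
        F.mean + Real.sqrt (2 * F.var) * ((1 - δ) * a n) ≤ R := by
  have hP1 := CQState.sum_weight F
  have hlog : 0 < Real.log 2 := Real.log_pos one_lt_two
  obtain ⟨σ, hσ, hσβ, hYσ⟩ := F.exists_sigma hv
  set β := Real.sqrt (2 * F.var) with hβdef
  have hβ : 0 < β := Real.sqrt_pos.mpr (by positivity)
  -- `κ = δ / 16` turns `1 + 8κ` into `1 + δ / 2`.
  obtain ⟨x₁, hx₁, N₀, htail⟩ := exists_tail_lower_bound F.weight_nonneg hP1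
    (F.sum_weight_centred hP1) hσ hYσ (κ := δ / 16) (by positivity) (by linarith)
  have hlim : ∀ c : ℝ, Tendsto (fun n => c * a n) atTop (𝓝 0) := fun c => by
    simpa using ha.const_mul c
  have hγ : 0 < Real.log 2 * β * (1 - δ / 2) := by
    have : 0 < 1 - δ / 2 := by linarith
    positivity
  have hx : ∀ᶠ n in atTop, Real.log 2 * β * (1 - δ / 2) * a n < x₁ :=
    (hlim _).eventually_lt_const hx₁
  have hN : ∀ᶠ n : ℕ in atTop,
      N₀ ≤ (Real.log 2 * β * (1 - δ / 2)) ^ 2 * ((n : ℝ) * a n ^ 2) :=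
    ((tendsto_nat_mul_sq ha').const_mul_atTop (by positivity)).eventually_ge_atTop N₀
  have hbig := ((tendsto_nat_mul_sq ha').const_mul_atTop
    (half_pos hδ0)).eventually_gt_atTop (Real.log 8)
  have hna := (tendsto_nat_mul ha').eventually_ge_atTop (4 / (β * δ))
  have hsmall : ∀ᶠ n in atTop, (Real.log 2)⁻¹ * a n < β * δ / 4 :=
    (hlim _).eventually_lt_const (by positivity)
  filter_upwards [eventually_pos_of_mul_sqrt ha', hx, hN, hbig, hna, hsmall]
    with n han hxn hNn hbn hnan hsn R hR0 C hC
  by_contra! hRlt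
  set R₀ := F.mean + β * ((1 - δ) * a n) with hR₀
  set E := (n : ℝ) * a n ^ 2 with hE
  set x := Real.log 2 * β * (1 - δ / 2) * a n with hxdef
  have hn0 : (0 : ℝ) ≤ n := Nat.cast_nonneg n
  -- The `1` pays for the ceiling, and `E / log 2` makes `2 ^ (-t) M ≤ exp (-E)`. Both fit in the
  -- gap between `1 - δ` in `R₀` and `1 - δ / 2` in `x`, each taking at most `β δ n a / 4`.
  set t := n * R₀ + 1 + E / Real.log 2 with ht
  have h1 := htail n x (by positivity) hxn.le (by rw [hxdef]; linarith)
  have hE0 : 0 ≤ E := mul_nonneg hn0 (sq_nonneg _)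
  have hexp : (1 + 8 * (δ / 16)) * (n * x ^ 2 / (2 * σ ^ 2)) ≤ (1 - δ / 2) * E := by
    have : (n : ℝ) * x ^ 2 / (2 * σ ^ 2) = (1 - δ / 2) ^ 2 * E := by
      rw [hσβ, hxdef, hE]
      field_simp
    rw [this]
    rw [← mul_assoc]
    exact mul_le_mul_of_nonneg_right (converse_exponent hδ0 hδ1) hE0
  have h2 : ∑ v : Fin n → X × d × d with n * x ≤ ∑ k, F.centred (v k), ∏ k, F.weight (v k)
      ≤ ∑ v : Fin n → X × d × d with t ≤ ∑ k, F.logRatio (v k), ∏ k, F.weight (v k) := by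
    refine Finset.sum_le_sum_of_subset_of_nonneg (fun v hv => ?_) fun v _ _ =>
      Finset.prod_nonneg fun k _ => F.weight_nonneg _
    rw [Finset.mem_filter] at hv ⊢
    refine ⟨hv.1, ?_⟩
    have hv2 := hv.2
    unfold centred at hv2
    rw [← Finset.mul_sum, Finset.sum_sub_distrib, Finset.sum_const, Finset.card_univ,
      Fintype.card_fin, nsmul_eq_mul, hxdef] at hv2
    have hv3 : n * (β * (1 - δ / 2) * a n) ≤ ∑ k, F.logRatio (v k) - n * F.mean := by
      refine le_of_mul_le_mul_left ?_ hlog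
      linarith
    have h3 : 1 ≤ β * δ / 4 * (n * a n) := by
      rw [div_le_iff₀ (by positivity)] at hnan
      linarith
    have h4 : E / Real.log 2 ≤ β * δ / 4 * (n * a n) := by
      have := mul_le_mul_of_nonneg_right hsn.le (mul_nonneg hn0 han.le)
      refine le_trans (le_of_eq ?_) this
      rw [hE]; field_simp
    rw [ht, hR₀]
    linarith
  have h3 := F.tail_le_minSum_tensorPower n t
  have h4 := F.minSum_le_errorProb C (Real.rpow_pos_of_pos two_pos (-t)).le
  have h5 : (2 : ℝ) ^ (-t) * (⌈(2 : ℝ) ^ ((n : ℝ) * R)⌉₊ : ℕ) ≤ Real.exp (-E) := by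
    have hceil := Nat.ceil_lt_add_one (Real.rpow_pos_of_pos two_pos ((n : ℝ) * R)).le
    have hle : (2 : ℝ) ^ ((n : ℝ) * R) ≤ (2 : ℝ) ^ ((n : ℝ) * R₀) :=
      Real.rpow_le_rpow_of_exponent_le one_le_two (mul_le_mul_of_nonneg_left hRlt.le hn0)
    have hone : (1 : ℝ) ≤ (2 : ℝ) ^ ((n : ℝ) * R) := Real.one_le_rpow one_le_two (by positivity)
    calc (2 : ℝ) ^ (-t) * (⌈(2 : ℝ) ^ ((n : ℝ) * R)⌉₊ : ℕ)
        ≤ (2 : ℝ) ^ (-t) * ((2 : ℝ) ^ ((n : ℝ) * R₀) * 2) :=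
          mul_le_mul_of_nonneg_left (by linarith) (Real.rpow_pos_of_pos two_pos _).le
      _ = (2 : ℝ) ^ (-(E / Real.log 2)) := by
          rw [← Real.rpow_add_one two_ne_zero, ← Real.rpow_add two_pos, ht]
          congr 1
          ring
      _ = Real.exp (-E) := by
          rw [Real.rpow_def_of_pos two_pos]
          congr 1
          field_simp
  -- Error probability and `2 ^ (-t) M` are each at most `exp (-E)`, which is too small against the
  -- tail once `δ E / 2 > log 8`.
  have h6 : 1 / 2 * Real.exp (-((1 - δ / 2) * E)) ≤ 4 * Real.exp (-E) := by
    have : Real.exp (-((1 - δ / 2) * E))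
        ≤ Real.exp (-((1 + 8 * (δ / 16)) * (n * x ^ 2 / (2 * σ ^ 2)))) :=
      Real.exp_le_exp.mpr (by linarith)
    linarith
  have h7 : 8 * Real.exp (-E) < Real.exp (-((1 - δ / 2) * E)) := by
    have : 8 * Real.exp (-E) = Real.exp (Real.log 8 + -E) := by
      rw [Real.exp_add, Real.exp_log (by norm_num)]
    rw [this]
    exact Real.exp_lt_exp.mpr (by linarith)
  linarith

end SpectralFamily

end Asymptotics

end Preliminaries

theorem theorem7 {X d : Type*} [Fintype X] [DecidableEq X] [Fintype d] [DecidableEq d]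
    (S : CQState X d) (hV : 0 < condInfoVariance S.toMatrix)
    (a : ℕ → ℝ) (ha : Filter.Tendsto a Filter.atTop (nhds 0))
    (ha' : Filter.Tendsto (fun n : ℕ => a n * Real.sqrt (n : ℝ)) Filter.atTop Filter.atTop) :
    (fun n : ℕ => optimalRate S n (Real.exp (-((n : ℝ) * a n ^ 2))) -
        (condEntropy S.toMatrix + Real.sqrt (2 * condInfoVariance S.toMatrix) * a n))
      =o[Filter.atTop] a := by
  obtain ⟨F⟩ := nonempty_spectralFamily S.weighted_posSemidef
  have hvar : condInfoVariance S.toMatrix = F.var := by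
    rw [S.toMatrix_eq_directSum, F.condInfoVariance_directSum]
    rfl
  have hmean : condEntropy S.toMatrix = F.mean := by
    rw [S.toMatrix_eq_directSum, F.condEntropy_directSum]
    rfl
  rw [hvar] at hV ⊢
  rw [hmean]
  set β := Real.sqrt (2 * F.var) with hβdef
  have hβ : 0 < β := Real.sqrt_pos.mpr (by positivity)
  rw [Asymptotics.isLittleO_iff]
  intro c hc
  set δ := min (1 / 2) (c / β) with hδ
  have hδ0 : 0 < δ := by positivity
  have hδ1 : δ < 1 := (min_le_left _ _).trans_lt (by norm_num)
  have hδc : β * δ ≤ c := by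
    have := mul_le_mul_of_nonneg_left (min_le_right (1 / 2) (c / β)) hβ.le
    rwa [mul_div_cancel₀ _ hβ.ne'] at this
  filter_upwards [eventually_pos_of_mul_sqrt ha', F.eventually_exists_code hV ha ha' hδ0,
    F.eventually_le_of_code hV ha ha' hδ0 hδ1] with n han ⟨hpos, C, hC⟩ hconv
  have hbdd : BddBelow {R : ℝ | 0 < R ∧ ∃ C : SWCode X d n R,
      C.errorProb S ≤ Real.exp (-((n : ℝ) * a n ^ 2))} := ⟨0, fun R hR => hR.1.le⟩
  have hupper : optimalRate S n (Real.exp (-((n : ℝ) * a n ^ 2)))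
      ≤ F.mean + β * ((1 + δ) * a n) := csInf_le hbdd ⟨hpos, C, hC⟩
  -- The code from achievability also shows that the set of rates is nonempty, without which `sInf`
  -- would be the default value `0`.
  have hlower : F.mean + β * ((1 - δ) * a n)
      ≤ optimalRate S n (Real.exp (-((n : ℝ) * a n ^ 2))) :=
    le_csInf ⟨_, hpos, C, hC⟩ fun R ⟨hR, C', hC'⟩ => hconv R hR C' hC'
  rw [Real.norm_eq_abs, Real.norm_eq_abs, abs_of_pos han, abs_le]
  have := mul_le_mul_of_nonneg_right hδc han.le
  constructor <;> linarith
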